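/- Let $1\le k\le n$ be integers. Let $\operatorname{Gr}(k+1,n+1)$ be the Grassmannian of $(k+1)$-dimensional linear subspaces of $\mathbb{R}^{n+1}$, and let $\operatorname{Graff}(k,n)$ be the set of $k$-dimensional affine subspaces $\mathbf{A}+b$ of $\mathbb{R}^n$ ($\mathbf{A}$ a $k$-dimensional linear subspace, $b\in\mathbb{R}^n$). $\operatorname{Gr}(k+1,n+1)$ is topologized by the orthogonal projection onto a subspace, and $\operatorname{Graff}(k,n)$ by the pair $(P_{\mathbf A},b_0)$, where $P_{\mathbf A}$ is the orthogonal projection onto $\mathbf A$ and $b_0$ is the point of $\mathbf A+b$ nearest to $0$. They carry the following charts. If $Y,Z$ are orthonormal bases of $\mathbf{V}$ and $\mathbf{V}^\perp$, then in the chart at $\mathbf V\in\operatorname{Gr}(k+1,n+1)$ the matrix $X\in\mathbb{R}^{(n-k)\times(k+1)}$ is the coordinate of $\operatorname{span}(Y+ZX)$. If $Y,Z$ are orthonormal bases of $\mathbf A$ and $\mathbf A^\perp$, then in the chart at $\mathbf{A}+b_0\in\operatorname{Graff}(k,n)$ with $b_0\perp\mathbf{A}$ the matrix $[X,c]\in\mathbb{R}^{(n-k)\times(k+1)}$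 is the coordinate of $\{b_0+Zc+(Y+ZX)u: u\in\mathbb{R}^k\}$. The canonical Riemannian metric of $\operatorname{Gr}(k+1,n+1)$ is $\operatorname{tr}(\Delta_1^{\mathsf T}\Delta_2)$, where a tangent vector at $\operatorname{span}(Y)$, $Y^{\mathsf T}Y=I$, is represented by a matrix $\Delta$ with $Y^{\mathsf T}\Delta=0$. The geodesic distance between two points of a Riemannian manifold is the infimum of the lengths of the $C^1$ paths that join them. Let $\mu$ be the uniform probability measure on $\operatorname{Gr}(k+1,n+1)$, that is, the law of $Q\mathbf{V}_0$ for a Haar distributed random $Q\in \operatorname{O}(n+1)$ and a fixed $\mathbf V_0$. Identify $\mathbb{R}^n$ with $\mathbb{R}^n\times\{0\}\subset\mathbb{R}^{n+1}$ and let $$j:\operatorname{Graff}(k,n)\to\operatorname{Gr}(k+1,n+1),\qquad j(\mathbf{A}+b)=\operatorname{span}(\mathbf{A}\cup\{b+e_{n+1}\}).$$ Then $\operatorname{Gr}(k+1,n+1)$ and $\operatorname{Graff}(k,n)$ are (Hausdorff, second countable) smooth manifolds, $j$ is a diffeomorphism onto an open subset of $\operatorname{Gr}(k+1,n+1)$,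 the canonical metric is a smooth Riemannian metric on $\operatorname{Gr}(k+1,n+1)$, and its pullback under $j$ is a smooth Riemannian metric on $\operatorname{Graff}(k,n)$. Moreover: 1. $\dim\operatorname{Graff}(k,n)=(n-k)(k+1)=\dim\operatorname{Gr}(k+1,n+1)$. 2. For the pullback metric, the geodesic distance between any two points $\mathbf{A}+b$ and $\mathbf{B}+c$ of $\operatorname{Graff}(k,n)$ is finite and equals the geodesic distance between $j(\mathbf{A}+b)$ and $j(\mathbf{B}+c)$ in $\operatorname{Gr}(k+1,n+1)$. 3. The complement of $j(\operatorname{Graff}(k,n))$ has $\mu$-measure zero. If $f:\operatorname{Graff}(k,n)\to\mathbb{R}$ is continuous and extends (through $j$) to a continuous function $\widetilde f:\operatorname{Gr}(k+1,n+1)\to\mathbb{R}$, then $\widetilde f$ attains its minimum and its maximum, and almost always they are attained in $\operatorname{Graff}(k,n)$, in the following two senses. (a) For Haar-almost every $Q\in \operatorname{O}(n+1)$, the rotated function $\mathbf{W}\mapsto\widetilde f(Q\mathbf{W})$ attains its minimum over $\operatorname{Gr}(k+1,n+1)$ at some point of $j(\operatorname{Graff}(k,n))$, and likewise its maximum. (b)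 If $\widetilde f$ is random and a random point $X$ is a minimizer (respectively a maximizer) of $\widetilde f$ whose law is absolutely continuous with respect to $\mu$, then almost surely $X\in j(\operatorname{Graff}(k,n))$, so the extremum is attained in $\operatorname{Graff}(k,n)$. -/

import Mathlib

open scoped Manifold ContDiff Matrix InnerProductSpace

namespace AffGr

/-- Euclidean space `ℝ^N`. -/
abbrev E (N : ℕ) : Type := EuclideanSpace ℝ (Fin N)

/-- The Grassmannian `Gr(m,N)`: the set of `m`-dimensional linear subspaces of `ℝ^N`. -/
def Gr (m N : ℕ) : Type := {V : Submodule ℝ (E N) // Module.finrank ℝ V = m}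

/-- The affine Grassmannian `Graff(k,n)`: the set of `k`-dimensional (nonempty) affine subspaces
of `ℝ^n`. -/
def Graff (k n : ℕ) : Type :=
  {S : AffineSubspace ℝ (E n) // (S : Set (E n)).Nonempty ∧ Module.finrank ℝ S.direction = k}

/-- The coordinate space of `Gr(m,N)`: real `(N-m) × m` matrices with the Frobenius inner
product. -/
abbrev GrModel (m N : ℕ) : Type := EuclideanSpace ℝ (Fin (N - m) × Fin m)

/-- The coordinate space of `Graff(k,n)`: real `(n-k) × (k+1)` matrices `[X, c]`. -/
abbrev GraffModel (k n : ℕ) : Type := EuclideanSpace ℝ (Fin (n - k) × Fin (k + 1))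

namespace Gr

variable {m N : ℕ}

/-- The orthogonal projection of `ℝ^N` onto the subspace. -/
noncomputable def proj (V : Gr m N) : E N →L[ℝ] E N := V.1.starProjection

/-- The Grassmannian carries the topology obtained by identifying a subspace with the orthogonal
projection onto it. -/
noncomputable instance : TopologicalSpace (Gr m N) := TopologicalSpace.induced proj inferInstance

theorem continuous_proj : Continuous (proj : Gr m N → _) := continuous_induced_dom

/-- An orthonormal basis of the `m`-plane `V`. -/
noncomputable def frame (V : Gr m N) : OrthonormalBasis (Fin m) ℝ V.1 :=
  (stdOrthonormalBasis ℝ V.1).reindex (finCongr V.2)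

theorem finrank_orthogonal (V : Gr m N) : Module.finrank ℝ (V.1ᗮ : Submodule ℝ (E N)) = N - m := by
  have h := Submodule.finrank_add_finrank_orthogonal V.1
  rw [V.2, finrank_euclideanSpace_fin] at h
  omega

/-- An orthonormal basis of the orthogonal complement of the `m`-plane `V`. -/
noncomputable def coframe (V : Gr m N) :
    OrthonormalBasis (Fin (N - m)) ℝ (V.1ᗮ : Submodule ℝ (E N)) :=
  (stdOrthonormalBasis ℝ (V.1ᗮ : Submodule ℝ (E N))).reindex (finCongr V.finrank_orthogonal)

/-- The columns of the matrix `Y` of orthonormal basis vectors of `V`. -/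
noncomputable def Y (V : Gr m N) (j : Fin m) : E N := (V.frame j : E N)

/-- The columns of the matrix `Z` of orthonormal basis vectors of the complement of `V`. -/
noncomputable def Z (V : Gr m N) (i : Fin (N - m)) : E N := (V.coframe i : E N)

theorem inner_Y_Y (V : Gr m N) (i j : Fin m) : ⟪V.Y i, V.Y j⟫_ℝ = if i = j then 1 else 0 := by
  have := orthonormal_iff_ite.1 V.frame.orthonormal i j
  simpa [Y] using this

theorem inner_Z_Z (V : Gr m N) (i j : Fin (N - m)) :
    ⟪V.Z i, V.Z j⟫_ℝ = if i = j then 1 else 0 := by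
  have := orthonormal_iff_ite.1 V.coframe.orthonormal i j
  simpa [Z] using this

theorem Y_mem (V : Gr m N) (j : Fin m) : V.Y j ∈ V.1 := (V.frame j).2

theorem Z_mem (V : Gr m N) (i : Fin (N - m)) : V.Z i ∈ V.1ᗮ := (V.coframe i).2

theorem inner_Y_Z (V : Gr m N) (j : Fin m) (i : Fin (N - m)) : ⟪V.Y j, V.Z i⟫_ℝ = 0 :=
  V.Z_mem i _ (V.Y_mem j)

theorem inner_Z_Y (V : Gr m N) (i : Fin (N - m)) (j : Fin m) : ⟪V.Z i, V.Y j⟫_ℝ = 0 := by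
  rw [real_inner_comm]; exact V.inner_Y_Z j i

theorem expand (V : Gr m N) (x : E N) :
    x = ∑ j, ⟪V.Y j, x⟫_ℝ • V.Y j + ∑ i, ⟪V.Z i, x⟫_ℝ • V.Z i := by
  have h1 := V.1.starProjection_add_starProjection_orthogonal x
  have h2 := congrArg (Subtype.val) (V.frame.sum_repr' (V.1.orthogonalProjectionOnto x))
  have h3 := congrArg (Subtype.val) (V.coframe.sum_repr' (V.1ᗮ.orthogonalProjectionOnto x))
  simp only [Submodule.coe_sum, Submodule.coe_smul,
    Submodule.inner_orthogonalProjectionOnto_eq_of_mem_left] at h2 h3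
  calc x = _ := h1.symm
    _ = _ := by
      rw [Submodule.starProjection_apply, Submodule.starProjection_apply, ← h2, ← h3]; rfl

/-- The columns of `Y + Z X`. -/
noncomputable def graphVec (V : Gr m N) (X : Matrix (Fin (N - m)) (Fin m) ℝ) (j : Fin m) : E N :=
  V.Y j + ∑ i, X i j • V.Z i

theorem inner_Y_graphVec (V : Gr m N) (X : Matrix (Fin (N - m)) (Fin m) ℝ) (i j : Fin m) :
    ⟪V.Y i, V.graphVec X j⟫_ℝ = if i = j then 1 else 0 := by
  simp [graphVec, inner_add_right, inner_sum, inner_smul_right, inner_Y_Y, inner_Y_Z]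

theorem inner_Z_graphVec (V : Gr m N) (X : Matrix (Fin (N - m)) (Fin m) ℝ) (i : Fin (N - m))
    (j : Fin m) : ⟪V.Z i, V.graphVec X j⟫_ℝ = X i j := by
  simp [graphVec, inner_add_right, inner_sum, inner_smul_right, inner_Z_Z, inner_Z_Y]

theorem linearIndependent_graphVec (V : Gr m N) (X : Matrix (Fin (N - m)) (Fin m) ℝ) :
    LinearIndependent ℝ (V.graphVec X) := by
  rw [Fintype.linearIndependent_iff]
  intro c hc i
  have := congrArg (fun v => ⟪V.Y i, v⟫_ℝ) hc
  simpa [inner_sum, inner_smul_right, inner_Y_graphVec] using this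

/-- The `m`-plane spanned by the columns of `Y + Z X`, i.e. the graph, over `V`, of the linear map
`V → Vᗮ` with matrix `X`. -/
noncomputable def graph (V : Gr m N) (X : Matrix (Fin (N - m)) (Fin m) ℝ) : Gr m N :=
  ⟨Submodule.span ℝ (Set.range (V.graphVec X)), by
    simpa using finrank_span_eq_card (V.linearIndependent_graphVec X)⟩

/-- The matrix `Yᵀ P_W Y`; it is invertible iff `W` is the graph of a map `V → Vᗮ`. -/
noncomputable def top (V W : Gr m N) : Matrix (Fin m) (Fin m) ℝ :=
  Matrix.of fun i j => ⟪V.Y i, W.proj (V.Y j)⟫_ℝ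

/-- The matrix `Zᵀ P_W Y`. -/
noncomputable def bot (V W : Gr m N) : Matrix (Fin (N - m)) (Fin m) ℝ :=
  Matrix.of fun i j => ⟪V.Z i, W.proj (V.Y j)⟫_ℝ

/-- The matrix `X` such that `W` is spanned by the columns of `Y + Z X`. -/
noncomputable def slope (V W : Gr m N) : Matrix (Fin (N - m)) (Fin m) ℝ :=
  V.bot W * (V.top W)⁻¹

theorem proj_mem (W : Gr m N) (x : E N) : W.proj x ∈ W.1 := W.1.starProjection_apply_mem x

theorem graphVec_slope_mem (V W : Gr m N) (h : (V.top W).det ≠ 0) (j : Fin m) :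
    V.graphVec (V.slope W) j ∈ W.1 := by
  have hu : IsUnit (V.top W).det := isUnit_iff_ne_zero.2 h
  have key : V.graphVec (V.slope W) j = ∑ l, (V.top W)⁻¹ l j • W.proj (V.Y l) := by
    rw [V.expand (∑ l, (V.top W)⁻¹ l j • W.proj (V.Y l)), graphVec]
    congr 1
    · have h1 : ∀ i, ⟪V.Y i, ∑ l, (V.top W)⁻¹ l j • W.proj (V.Y l)⟫_ℝ
          = (V.top W * (V.top W)⁻¹) i j := by
        intro i
        simp [inner_sum, inner_smul_right, Matrix.mul_apply, top, mul_comm]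
      simp [h1, Matrix.mul_nonsing_inv _ hu, Matrix.one_apply]
    · refine Finset.sum_congr rfl fun i _ => ?_
      congr 1
      simp [inner_sum, inner_smul_right, Matrix.mul_apply, slope, bot, mul_comm]
  rw [key]
  exact Submodule.sum_mem _ fun l _ => Submodule.smul_mem _ _ (W.proj_mem _)

theorem graph_slope (V W : Gr m N) (h : (V.top W).det ≠ 0) : V.graph (V.slope W) = W := by
  apply Subtype.ext
  refine Submodule.eq_of_le_of_finrank_eq ?_ ((V.graph (V.slope W)).2.trans W.2.symm)
  refine Submodule.span_le.2 ?_
  rintro _ ⟨j, rfl⟩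
  exact V.graphVec_slope_mem W h j

theorem bot_graph (V : Gr m N) (X : Matrix (Fin (N - m)) (Fin m) ℝ) :
    V.bot (V.graph X) = X * V.top (V.graph X) := by
  ext i l
  obtain ⟨c, hc⟩ := (Submodule.mem_span_range_iff_exists_fun ℝ).1
    ((V.graph X).proj_mem (V.Y l))
  simp only [bot, top, Matrix.of_apply, Matrix.mul_apply, ← hc]
  simp [inner_sum, inner_smul_right, inner_Y_graphVec, inner_Z_graphVec, mul_comm]

theorem det_top_graph (V : Gr m N) (X : Matrix (Fin (N - m)) (Fin m) ℝ) :
    (V.top (V.graph X)).det ≠ 0 := by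
  intro h0
  obtain ⟨v, hv, hv0⟩ := Matrix.exists_mulVec_eq_zero_iff.2 h0
  set x : E N := ∑ j, v j • V.Y j with hx
  have hY : ∀ i, ⟪V.Y i, (V.graph X).proj x⟫_ℝ = 0 := by
    intro i
    have := congrFun hv0 i
    simpa [Matrix.mulVec, dotProduct, top, hx, inner_sum, inner_smul_right, mul_comm] using this
  obtain ⟨c, hc⟩ := (Submodule.mem_span_range_iff_exists_fun ℝ).1 ((V.graph X).proj_mem x)
  have hP : (V.graph X).proj x = 0 := by
    have hc0 : ∀ i, c i = 0 := by
      intro i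
      have := hY i
      rw [← hc] at this
      simpa [inner_sum, inner_smul_right, inner_Y_graphVec] using this
    rw [← hc]; simp [hc0]
  have hperp : x ∈ (V.graph X).1ᗮ := ((V.graph X).1.starProjection_apply_eq_zero_iff).1 hP
  apply hv
  funext j
  have hj := hperp (V.graphVec X j) (Submodule.subset_span ⟨j, rfl⟩)
  rw [real_inner_comm] at hj
  simpa [hx, sum_inner, inner_smul_left, inner_Y_graphVec] using hj

theorem slope_graph (V : Gr m N) (X : Matrix (Fin (N - m)) (Fin m) ℝ) :
    V.slope (V.graph X) = X := by
  rw [slope, bot_graph, Matrix.mul_assoc,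
    Matrix.mul_nonsing_inv _ (isUnit_iff_ne_zero.2 (V.det_top_graph X)), Matrix.mul_one]

theorem det_top_self (V : Gr m N) : (V.top V).det ≠ 0 := by
  have : V.top V = 1 := by
    ext i j
    have : V.proj (V.Y j) = V.Y j := Submodule.starProjection_eq_self_iff.2 (V.Y_mem j)
    simp [top, this, inner_Y_Y, Matrix.one_apply]
  simp [this]

theorem continuous_top (V : Gr m N) : Continuous V.top := by
  refine continuous_matrix fun i j => ?_
  exact continuous_const.inner (continuous_proj.clm_apply continuous_const)

theorem continuous_bot (V : Gr m N) : Continuous V.bot := by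
  refine continuous_matrix fun i j => ?_
  exact continuous_const.inner (continuous_proj.clm_apply continuous_const)

theorem continuousOn_slope (V : Gr m N) : ContinuousOn V.slope {W | (V.top W).det ≠ 0} := by
  have : ∀ W, V.slope W = (V.top W).det⁻¹ • (V.bot W * (V.top W).adjugate) := by
    intro W
    simp [slope, Matrix.inv_def, Ring.inverse_eq_inv']
  simp only [funext this]
  have h1 : ContinuousOn (fun W => (V.top W).det⁻¹) {W | (V.top W).det ≠ 0} :=
    (V.continuous_top.matrix_det.continuousOn).inv₀ fun W hW => hW
  exact h1.smul (V.continuous_bot.matrix_mul V.continuous_top.matrix_adjugate).continuousOn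

/-- The Gram matrix `(Y + Z X)ᵀ (Y + Z X)`. -/
noncomputable def gram (V : Gr m N) (X : Matrix (Fin (N - m)) (Fin m) ℝ) :
    Matrix (Fin m) (Fin m) ℝ := Matrix.of fun i j => ⟪V.graphVec X i, V.graphVec X j⟫_ℝ

theorem det_gram (V : Gr m N) (X : Matrix (Fin (N - m)) (Fin m) ℝ) : (V.gram X).det ≠ 0 := by
  intro h0
  obtain ⟨v, hv, hv0⟩ := Matrix.exists_mulVec_eq_zero_iff.2 h0
  apply hv
  have hx : ∑ j, v j • V.graphVec X j = 0 := by
    rw [← inner_self_eq_zero (𝕜 := ℝ), sum_inner]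
    refine Finset.sum_eq_zero fun i _ => ?_
    have := congrFun hv0 i
    simp only [Matrix.mulVec, dotProduct, gram, Matrix.of_apply, Pi.zero_apply] at this
    rw [inner_smul_left, inner_sum]
    simp only [inner_smul_right]
    rw [Finset.sum_congr rfl fun j _ => mul_comm (v j) _, this, mul_zero]
  funext j
  exact Fintype.linearIndependent_iff.1 (V.linearIndependent_graphVec X) v hx j

theorem proj_graph_apply (V : Gr m N) (X : Matrix (Fin (N - m)) (Fin m) ℝ) (x : E N) :
    (V.graph X).proj x =
      ∑ j, (∑ l, (V.gram X)⁻¹ j l * ⟪V.graphVec X l, x⟫_ℝ) • V.graphVec X j := by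
  symm
  change _ = (V.graph X).1.starProjection x
  symm
  refine Submodule.eq_starProjection_of_mem_of_inner_eq_zero
    (K := (V.graph X).1)
    (Submodule.sum_mem _ fun j _ => Submodule.smul_mem _ _
      (Submodule.subset_span (Set.mem_range_self j))) ?_
  intro w hw
  have hG := Matrix.mul_nonsing_inv _ (isUnit_iff_ne_zero.2 (V.det_gram X))
  have key : ∀ i, ⟪V.graphVec X i,
      ∑ j, (∑ l, (V.gram X)⁻¹ j l * ⟪V.graphVec X l, x⟫_ℝ) • V.graphVec X j⟫_ℝ
        = ⟪V.graphVec X i, x⟫_ℝ := by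
    intro i
    have h1 : (V.gram X *ᵥ ((V.gram X)⁻¹ *ᵥ fun l => ⟪V.graphVec X l, x⟫_ℝ)) i
        = ⟪V.graphVec X i, x⟫_ℝ := by
      rw [Matrix.mulVec_mulVec, hG, Matrix.one_mulVec]
    rw [← h1]
    simp [inner_sum, inner_smul_right, Matrix.mulVec, dotProduct, gram, mul_comm]
  obtain ⟨c, rfl⟩ := (Submodule.mem_span_range_iff_exists_fun ℝ).1 hw
  rw [inner_sum]
  refine Finset.sum_eq_zero fun i _ => ?_
  rw [inner_smul_right, real_inner_comm, inner_sub_right, key, sub_self, mul_zero]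

theorem continuous_graphVec (V : Gr m N) (j : Fin m) : Continuous fun X => V.graphVec X j := by
  unfold graphVec
  fun_prop

theorem continuous_gram_inv (V : Gr m N) : Continuous fun X => (V.gram X)⁻¹ := by
  have h : Continuous V.gram := continuous_matrix fun i j =>
    (V.continuous_graphVec i).inner (V.continuous_graphVec j)
  simp only [Matrix.inv_def, Ring.inverse_eq_inv']
  exact (h.matrix_det.inv₀ V.det_gram).smul h.matrix_adjugate

theorem continuous_graph (V : Gr m N) : Continuous V.graph := by
  refine continuous_induced_rng.2 ?_
  refine continuous_clm_apply.2 fun x => ?_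
  simp only [Function.comp_apply, proj_graph_apply]
  have h1 : ∀ j, Continuous fun X => ∑ l, (V.gram X)⁻¹ j l * ⟪V.graphVec X l, x⟫_ℝ := fun j =>
    continuous_finsetSum _ fun l _ => (V.continuous_gram_inv.matrix_elem j l).mul
      ((V.continuous_graphVec l).inner continuous_const)
  exact continuous_finsetSum _ fun j _ => (h1 j).smul (V.continuous_graphVec j)

/-- The chart of the Grassmannian centred at `V`: with `Y`, `Z` orthonormal bases of `V` and `Vᗮ`,
the `m`-plane spanned by the columns of `Y + Z X` has coordinates `X`. -/
noncomputable def chart (V : Gr m N) : OpenPartialHomeomorph (Gr m N) (GrModel m N) where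
  toFun W := WithLp.toLp 2 fun p => V.slope W p.1 p.2
  invFun x := V.graph (Matrix.of fun i j => x (i, j))
  source := {W | (V.top W).det ≠ 0}
  target := Set.univ
  map_source' _ _ := Set.mem_univ _
  map_target' _ _ := V.det_top_graph _
  left_inv' W hW := V.graph_slope W hW
  right_inv' x _ := by
    ext p
    simp [slope_graph]
  open_source := isOpen_ne_fun V.continuous_top.matrix_det continuous_const
  open_target := isOpen_univ
  continuousOn_toFun := by
    refine (PiLp.continuous_toLp 2 _).comp_continuousOn ?_
    refine continuousOn_pi.2 fun p => ?_
    exact ((continuous_id.matrix_elem p.1 p.2).comp_continuousOn V.continuousOn_slope)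
  continuousOn_invFun := by
    refine Continuous.continuousOn (V.continuous_graph.comp ?_)
    refine continuous_matrix fun i j => ?_
    simp only [Matrix.of_apply]
    fun_prop

/-- The Grassmannian as a manifold modelled on `(N-m) × m` matrices. -/
noncomputable instance : ChartedSpace (GrModel m N) (Gr m N) where
  atlas := Set.range chart
  chartAt := chart
  mem_chart_source V := V.det_top_self
  chart_mem_atlas V := ⟨V, rfl⟩

end Gr

namespace Graff

variable {k n : ℕ}

/-- The linear part `A` of the affine subspace `A + b`. -/
noncomputable def dir (S : Graff k n) : Gr k n := ⟨S.1.direction, S.2.2⟩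

/-- The displacement `b₀ ⊥ A` of the affine subspace `A + b = A + b₀`: its point nearest to `0`. -/
noncomputable def foot (S : Graff k n) : E n :=
  haveI : Nonempty S.1 := S.2.1.to_subtype
  (EuclideanGeometry.orthogonalProjection S.1 0 : E n)

/-- The projection affine coordinates `[P_A, b₀]` of a flat, where `P_A` is the orthogonal
projection onto the linear part. -/
noncomputable def projCoord (S : Graff k n) : (E n →L[ℝ] E n) × E n := (S.dir.proj, S.foot)

/-- The affine Grassmannian carries the topology given by projection affine coordinates. -/
noncomputable instance : TopologicalSpace (Graff k n) :=
  TopologicalSpace.induced projCoord inferInstance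

theorem continuous_projCoord : Continuous (projCoord : Graff k n → _) := continuous_induced_dom

theorem continuous_dir : Continuous (dir : Graff k n → _) :=
  continuous_induced_rng.2 (continuous_fst.comp continuous_projCoord)

theorem continuous_foot : Continuous (foot : Graff k n → _) :=
  continuous_snd.comp continuous_projCoord

theorem foot_mem (S : Graff k n) : S.foot ∈ S.1 := by
  have : Nonempty S.1 := S.2.1.to_subtype
  exact EuclideanGeometry.orthogonalProjection_mem _

theorem foot_eq (S : Graff k n) {p : E n} (hp : p ∈ S.1) : S.foot = p - S.dir.proj p := by
  have : Nonempty S.1 := S.2.1.to_subtype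
  have h := EuclideanGeometry.orthogonalProjection_apply_mem S.1 (p := (0 : E n)) hp
  rw [foot, h]
  have : (S.1.direction.orthogonalProjectionOnto ((0 : E n) -ᵥ p) : E n) = - S.dir.proj p := by
    rw [vsub_eq_sub, zero_sub, map_neg]; rfl
  rw [this, vadd_eq_add]
  abel

theorem inner_foot (S : Graff k n) {v : E n} (hv : v ∈ S.dir.1) : ⟪v, S.foot⟫_ℝ = 0 := by
  rw [S.foot_eq S.foot_mem]
  exact S.dir.1.sub_starProjection_mem_orthogonal _ v hv

theorem ext_foot {S T : Graff k n} (h : S.dir = T.dir) {p : E n} (hS : p ∈ S.1) (hT : p ∈ T.1) :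
    S = T :=
  Subtype.ext (AffineSubspace.ext_of_direction_eq (congrArg Subtype.val h) ⟨p, hS, hT⟩)

/-- The `k`-flat through `p` with linear part `V`. -/
noncomputable def mk (V : Gr k n) (p : E n) : Graff k n :=
  ⟨AffineSubspace.mk' p V.1, AffineSubspace.mk'_nonempty _ _, by
    rw [AffineSubspace.direction_mk']; exact V.2⟩

theorem dir_mk (V : Gr k n) (p : E n) : (mk V p).dir = V :=
  Subtype.ext (AffineSubspace.direction_mk' _ _)

theorem mem_mk (V : Gr k n) (p : E n) : p ∈ (mk V p).1 := AffineSubspace.self_mem_mk' _ _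

theorem foot_mk (V : Gr k n) (p : E n) : (mk V p).foot = p - V.proj p := by
  rw [foot_eq _ (mem_mk V p), dir_mk]

/-- The base point `b₀ + Z c` of the flat with coordinates `[X, c]` around `S`. -/
noncomputable def shift (S : Graff k n) (c : Fin (n - k) → ℝ) : E n :=
  S.foot + ∑ i, c i • S.dir.Z i

/-- The last column `c` of the coordinates of `T` around `S`. -/
noncomputable def offset (S T : Graff k n) (i : Fin (n - k)) : ℝ :=
  ⟪S.dir.Z i, T.foot - S.foot⟫_ℝ - ∑ j, S.dir.slope T.dir i j * ⟪S.dir.Y j, T.foot⟫_ℝ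

theorem shift_offset_mem (S T : Graff k n) (h : (S.dir.top T.dir).det ≠ 0) :
    S.shift (S.offset T) ∈ T.1 := by
  have key : S.shift (S.offset T) =
      (-∑ j, ⟪S.dir.Y j, T.foot⟫_ℝ • S.dir.graphVec (S.dir.slope T.dir) j) +ᵥ T.foot := by
    have e1 := S.dir.expand (T.foot - S.foot)
    have e2 : ∀ j, ⟪S.dir.Y j, T.foot - S.foot⟫_ℝ = ⟪S.dir.Y j, T.foot⟫_ℝ := fun j => by
      rw [inner_sub_right, S.inner_foot (S.dir.Y_mem j), sub_zero]
    simp only [e2] at e1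
    have e3 : T.foot = S.foot + (∑ j, ⟪S.dir.Y j, T.foot⟫_ℝ • S.dir.Y j
        + ∑ i, ⟪S.dir.Z i, T.foot - S.foot⟫_ℝ • S.dir.Z i) := by
      rw [← e1]; abel
    have e4 : ∑ j, ⟪S.dir.Y j, T.foot⟫_ℝ • S.dir.graphVec (S.dir.slope T.dir) j =
        ∑ j, ⟪S.dir.Y j, T.foot⟫_ℝ • S.dir.Y j +
        ∑ i, (∑ j, S.dir.slope T.dir i j * ⟪S.dir.Y j, T.foot⟫_ℝ) • S.dir.Z i := by
      simp only [Gr.graphVec, smul_add, Finset.sum_add_distrib, Finset.smul_sum, Finset.sum_smul,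
        smul_smul]
      rw [Finset.sum_comm (s := Finset.univ (α := Fin k))]
      simp only [mul_comm]
    rw [vadd_eq_add, e4]
    simp only [shift, offset, sub_smul, Finset.sum_sub_distrib]
    generalize (∑ j, ⟪S.dir.Y j, T.foot⟫_ℝ • S.dir.Y j) = a at *
    generalize (∑ i, ⟪S.dir.Z i, T.foot - S.foot⟫_ℝ • S.dir.Z i) = b at *
    generalize (∑ i, (∑ j, S.dir.slope T.dir i j * ⟪S.dir.Y j, T.foot⟫_ℝ) • S.dir.Z i) = d at *
    rw [e3]
    abel
  rw [key]
  refine AffineSubspace.vadd_mem_of_mem_direction ?_ T.foot_mem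
  exact Submodule.neg_mem _ (Submodule.sum_mem _ fun j _ => Submodule.smul_mem _ _
    (S.dir.graphVec_slope_mem T.dir h j))

theorem offset_mk (S : Graff k n) (X : Matrix (Fin (n - k)) (Fin k) ℝ) (c : Fin (n - k) → ℝ) :
    S.offset (mk (S.dir.graph X) (S.shift c)) = c := by
  obtain ⟨t, ht⟩ := (Submodule.mem_span_range_iff_exists_fun ℝ).1
    ((S.dir.graph X).proj_mem (S.shift c))
  have hf : (mk (S.dir.graph X) (S.shift c)).foot =
      S.foot + ∑ i, c i • S.dir.Z i - ∑ j, t j • S.dir.graphVec X j := by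
    rw [foot_mk, ← ht]; rfl
  funext i
  have hZ : ⟪S.dir.Z i, (mk (S.dir.graph X) (S.shift c)).foot - S.foot⟫_ℝ
      = c i - ∑ j, t j * X i j := by
    rw [hf, show S.foot + ∑ i, c i • S.dir.Z i - ∑ j, t j • S.dir.graphVec X j - S.foot
      = ∑ i, c i • S.dir.Z i - ∑ j, t j • S.dir.graphVec X j by abel]
    simp [inner_sub_right, inner_sum, inner_smul_right, Gr.inner_Z_Z, Gr.inner_Z_graphVec]
  have hY : ∀ j, ⟪S.dir.Y j, (mk (S.dir.graph X) (S.shift c)).foot⟫_ℝ = - t j := by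
    intro j
    rw [hf]
    simp [inner_sub_right, inner_add_right, inner_sum, inner_smul_right, Gr.inner_Y_Z,
      Gr.inner_Y_graphVec, S.inner_foot (S.dir.Y_mem j)]
  rw [offset, dir_mk, Gr.slope_graph, hZ]
  simp [hY, mul_comm]

/-- The chart of the affine Grassmannian centred at `S = A + b₀`: with `Y`, `Z` orthonormal bases
of `A` and `Aᗮ`, the flat `{b₀ + Z c + (Y + Z X) u : u ∈ ℝ^k}` has coordinates `[X, c]`. -/
noncomputable def chart (S : Graff k n) : OpenPartialHomeomorph (Graff k n) (GraffModel k n) where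
  toFun T := WithLp.toLp 2 fun p =>
    Fin.lastCases (motive := fun _ => ℝ) (S.offset T p.1) (fun j => S.dir.slope T.dir p.1 j) p.2
  invFun x := mk (S.dir.graph (Matrix.of fun i j => x (i, j.castSucc)))
    (S.shift fun i => x (i, Fin.last k))
  source := {T | (S.dir.top T.dir).det ≠ 0}
  target := Set.univ
  map_source' _ _ := Set.mem_univ _
  map_target' x _ := by
    simp only [Set.mem_ofPred_eq, dir_mk]
    exact S.dir.det_top_graph _
  left_inv' T hT := by
    simp only [Fin.lastCases_last, Fin.lastCases_castSucc]
    refine ext_foot ?_ (mem_mk _ _) (S.shift_offset_mem T hT)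
    rw [dir_mk]
    exact S.dir.graph_slope _ hT
  right_inv' x _ := by
    ext ⟨i, j⟩
    refine Fin.lastCases ?_ (fun j => ?_) j
    · simp [offset_mk]
    · simp [dir_mk, Gr.slope_graph]
  open_source := isOpen_ne_fun (S.dir.continuous_top.comp continuous_dir).matrix_det
    continuous_const
  open_target := isOpen_univ
  continuousOn_toFun := by
    have hs : ∀ i j, ContinuousOn (fun T : Graff k n => S.dir.slope T.dir i j)
        {T | (S.dir.top T.dir).det ≠ 0} := fun i j =>
      (continuous_id.matrix_elem i j).comp_continuousOn
        (S.dir.continuousOn_slope.comp continuous_dir.continuousOn fun T hT => hT)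
    refine (PiLp.continuous_toLp 2 _).comp_continuousOn ?_
    refine continuousOn_pi.2 ?_
    rintro ⟨i, j⟩
    refine Fin.lastCases ?_ (fun j => ?_) j
    · simp only [Fin.lastCases_last]
      refine ContinuousOn.sub ?_ (continuousOn_finsetSum _ fun j _ => (hs i j).mul ?_)
      · exact (continuous_const.inner (continuous_foot.sub continuous_const)).continuousOn
      · exact (continuous_const.inner continuous_foot).continuousOn
    · simpa only [Fin.lastCases_castSucc] using hs i j
  continuousOn_invFun := by
    refine Continuous.continuousOn (continuous_induced_rng.2 ?_)
    have hg : Continuous fun x : GraffModel k n =>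
        (S.dir.graph (Matrix.of fun i j => x (i, j.castSucc))).proj := by
      refine Gr.continuous_proj.comp (S.dir.continuous_graph.comp (continuous_matrix fun i j => ?_))
      simp only [Matrix.of_apply]
      fun_prop
    have hp : Continuous fun x : GraffModel k n => S.shift fun i => x (i, Fin.last k) := by
      unfold shift
      fun_prop
    simp only [Function.comp_def, projCoord, dir_mk, foot_mk]
    exact hg.prodMk (hp.sub (hg.clm_apply hp))

/-- The affine Grassmannian as a manifold modelled on `(n-k) × (k+1)` matrices. -/
noncomputable instance : ChartedSpace (GraffModel k n) (Graff k n) where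
  atlas := Set.range chart
  chartAt := chart
  mem_chart_source S := S.dir.det_top_self
  chart_mem_atlas S := ⟨S, rfl⟩

end Graff

/-- The inclusion of `ℝ^n` in `ℝ^(n+1)` as the vectors with last coordinate `0`. -/
noncomputable def incl (n : ℕ) : E n →ₗ[ℝ] E (n + 1) where
  toFun x := WithLp.toLp 2 (Fin.snoc (α := fun _ => ℝ) (fun i => x i) 0)
  map_add' x y := by
    ext i
    refine Fin.lastCases ?_ (fun i => ?_) i <;> simp
  map_smul' c x := by
    ext i
    refine Fin.lastCases ?_ (fun i => ?_) i <;> simp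

/-- The last standard basis vector `e_{n+1}` of `ℝ^(n+1)`. -/
noncomputable def eLast (n : ℕ) : E (n + 1) := EuclideanSpace.single (Fin.last n) 1

theorem incl_castSucc {n : ℕ} (x : E n) (i : Fin n) : incl n x i.castSucc = x i := by
  simp [incl]

theorem incl_last {n : ℕ} (x : E n) : incl n x (Fin.last n) = 0 := by
  simp [incl]

theorem eLast_last (n : ℕ) : eLast n (Fin.last n) = 1 := by
  simp [eLast]

theorem incl_injective (n : ℕ) : Function.Injective (incl n) := by
  intro x y h
  ext i
  rw [← incl_castSucc x i, ← incl_castSucc y i, h]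

/-- The subspace `span (A ∪ {b + e_{n+1}})` of `ℝ^(n+1)`. -/
noncomputable def lift {n : ℕ} (A : Submodule ℝ (E n)) (b : E n) : Submodule ℝ (E (n + 1)) :=
  Submodule.span ℝ (incl n '' A ∪ {incl n b + eLast n})

theorem lift_eq_sup {n : ℕ} (A : Submodule ℝ (E n)) (b : E n) :
    lift A b = A.map (incl n) ⊔ Submodule.span ℝ {incl n b + eLast n} := by
  rw [lift, Submodule.span_union, Submodule.span_image, Submodule.span_eq]

theorem finrank_lift {n : ℕ} (A : Submodule ℝ (E n)) (b : E n) :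
    Module.finrank ℝ (lift A b) = Module.finrank ℝ A + 1 := by
  have hlast : (incl n b + eLast n) (Fin.last n) = 1 := by
    rw [PiLp.add_apply, incl_last, eLast_last, zero_add]
  have hne : incl n b + eLast n ≠ 0 := by
    intro h
    rw [h] at hlast
    simp at hlast
  have hdisj : A.map (incl n) ⊓ Submodule.span ℝ {incl n b + eLast n} = ⊥ := by
    rw [Submodule.eq_bot_iff]
    rintro x ⟨⟨a, -, rfl⟩, hx⟩
    obtain ⟨c, hc⟩ := Submodule.mem_span_singleton.1 hx
    have h0 : c = 0 := by
      have := congrArg (fun v : E (n + 1) => v (Fin.last n)) hc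
      simpa only [PiLp.smul_apply, hlast, incl_last, smul_eq_mul, mul_one] using this
    rw [← hc, h0, zero_smul]
  have h := Submodule.finrank_sup_add_finrank_inf_eq (A.map (incl n))
    (Submodule.span ℝ {incl n b + eLast n})
  rw [hdisj, finrank_bot, add_zero, finrank_span_singleton hne,
    ← (Submodule.equivMapOfInjective (incl n) (incl_injective n) A).finrank_eq] at h
  rw [lift_eq_sup, h]

/-- The subspace `span (A ∪ {b + e_{n+1}})` depends only on `A + b`. -/
theorem lift_congr {n : ℕ} (A : Submodule ℝ (E n)) {b b' : E n} (h : b' - b ∈ A) :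
    lift A b = lift A b' := by
  have aux : ∀ {c c' : E n}, c' - c ∈ A → lift A c ≤ lift A c' := by
    intro c c' hc
    refine Submodule.span_le.2 (Set.union_subset ?_ ?_)
    · exact fun x hx => Submodule.subset_span (Or.inl hx)
    · rintro _ rfl
      have h1 : incl n (c' - c) ∈ lift A c' := Submodule.subset_span (Or.inl ⟨_, hc, rfl⟩)
      have h2 : incl n c' + eLast n ∈ lift A c' := Submodule.subset_span (Or.inr rfl)
      have h3 := Submodule.sub_mem _ h2 h1
      rw [map_sub] at h3
      have e : incl n c' + eLast n - (incl n c' - incl n c) = incl n c + eLast n := by abel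
      rw [e] at h3
      exact h3
  refine le_antisymm (aux h) (aux ?_)
  rw [← neg_sub]
  exact Submodule.neg_mem _ h

/-- The embedding `j : Graff(k,n) → Gr(k+1,n+1)`, `A + b ↦ span (A ∪ {b + e_{n+1}})`. -/
noncomputable def j {k n : ℕ} (S : Graff k n) : Gr (k + 1) (n + 1) :=
  ⟨lift S.1.direction S.2.1.some, by rw [finrank_lift, S.2.2]⟩

/-- The displacement in the definition of `j` may be any point of the flat. -/
theorem j_eq {k n : ℕ} (S : Graff k n) {b : E n} (hb : b ∈ S.1) :
    (j S).1 = lift S.1.direction b :=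
  lift_congr _ (AffineSubspace.vsub_mem_direction hb S.2.1.some_mem)

/-- The canonical Riemannian metric of `Gr(m,N)`. A tangent vector at `V` is represented by its
coordinates `X` in the chart centred at `V`, that is, by the matrix `Δ = Z X` with `Yᵀ Δ = 0`, where
`Y` and `Z` are orthonormal bases of `V` and `Vᗮ`; the metric is `tr (Δ₁ᵀ Δ₂) = tr (X₁ᵀ X₂)`. -/
noncomputable def grMetric (m N : ℕ) :
    Bundle.RiemannianMetric (fun V : Gr m N => TangentSpace 𝓘(ℝ, GrModel m N) V) where
  inner _ := (innerSL ℝ : GrModel m N →L[ℝ] GrModel m N →L[ℝ] ℝ)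
  symm _ v w := real_inner_comm (F := GrModel m N) w v
  pos _ v hv := real_inner_self_pos (F := GrModel m N).2 hv
  continuousAt _ := by
    have h : Continuous fun v : GrModel m N => ⟪v, v⟫_ℝ := continuous_id.inner continuous_id
    exact h.continuousAt
  isVonNBounded V := (riemannianMetricVectorSpace (GrModel m N)).isVonNBounded 0

section GeodesicDistance

open scoped Bundle

/-- The geodesic distance of a Riemannian metric: the infimum of the lengths of `C^1` paths. -/
noncomputable def geodesicDist {F : Type*} [NormedAddCommGroup F] [NormedSpace ℝ F] {M : Type*}
    [TopologicalSpace M] [ChartedSpace F M]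
    (g : Bundle.RiemannianMetric (fun x : M => TangentSpace 𝓘(ℝ, F) x)) (x y : M) : ENNReal :=
  letI : Bundle.RiemannianBundle (fun x : M => TangentSpace 𝓘(ℝ, F) x) := ⟨g⟩
  Manifold.riemannianEDist 𝓘(ℝ, F) x y

end GeodesicDistance

/-- The orthogonal group `O(N)`: real matrices with `Q Qᵀ = Qᵀ Q = 1`. -/
abbrev O (N : ℕ) : Type := Matrix.unitaryGroup (Fin N) ℝ

instance (N : ℕ) : CompactSpace (O N) := by
  refine isCompact_iff_compactSpace.1 ?_
  have hb : IsCompact (Set.univ.pi fun _ : Fin N =>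
      Set.univ.pi fun _ : Fin N => Set.Icc (-1 : ℝ) 1) :=
    isCompact_univ_pi fun _ => isCompact_univ_pi fun _ => isCompact_Icc
  refine hb.of_isClosed_subset (isClosed_unitary (R := Matrix (Fin N) (Fin N) ℝ)) ?_
  intro U hU i _ j _
  have := entry_norm_bound_of_unitary (𝕜 := ℝ) hU i j
  exact abs_le.1 this

instance (N : ℕ) : MeasurableSpace (O N) := borel _
instance (N : ℕ) : BorelSpace (O N) := ⟨rfl⟩
noncomputable instance (m N : ℕ) : MeasurableSpace (Gr m N) := borel _
instance (m N : ℕ) : BorelSpace (Gr m N) := ⟨rfl⟩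

/-- The Haar probability measure of `O(N)`. -/
noncomputable def haarO (N : ℕ) : MeasureTheory.Measure (O N) :=
  MeasureTheory.Measure.haarMeasure ⊤

instance (N : ℕ) : MeasureTheory.IsProbabilityMeasure (haarO N) :=
  ⟨MeasureTheory.Measure.haarMeasure_self (K₀ := (⊤ : TopologicalSpace.PositiveCompacts (O N)))⟩

/-- The linear action of an orthogonal matrix on `ℝ^N`. -/
noncomputable def act {N : ℕ} (Q : O N) : E N →L[ℝ] E N := Matrix.toEuclideanCLM (𝕜 := ℝ) Q.1

theorem act_mul {N : ℕ} (Q R : O N) (x : E N) : act (Q * R) x = act Q (act R x) := by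
  simp [act]

theorem act_inv_act {N : ℕ} (Q : O N) (x : E N) : act Q⁻¹ (act Q x) = x := by
  rw [← act_mul, inv_mul_cancel]; simp [act]

theorem act_injective {N : ℕ} (Q : O N) : Function.Injective (act Q) :=
  Function.LeftInverse.injective (act_inv_act Q)

theorem inner_act {N : ℕ} (Q : O N) (x y : E N) : ⟪act Q x, y⟫_ℝ = ⟪x, act Q⁻¹ y⟫_ℝ := by
  have : act Q⁻¹ = ContinuousLinearMap.adjoint (act Q) := by
    rw [← ContinuousLinearMap.star_eq_adjoint, act, act, ← map_star]; rfl
  rw [this, ContinuousLinearMap.adjoint_inner_right]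

theorem continuous_act {N : ℕ} (x : E N) : Continuous fun Q : O N => act Q x := by
  refine (PiLp.continuous_toLp 2 _).comp ?_
  exact Continuous.matrix_mulVec continuous_subtype_val continuous_const

/-- The image `Q V` of a subspace under an orthogonal matrix. -/
noncomputable def rotate {m N : ℕ} (Q : O N) (V : Gr m N) : Gr m N :=
  ⟨V.1.map (act Q : E N →ₗ[ℝ] E N), by
    rw [← (Submodule.equivMapOfInjective (act Q : E N →ₗ[ℝ] E N) (act_injective Q) V.1).finrank_eq,
      V.2]⟩

theorem proj_rotate {m N : ℕ} (Q : O N) (V : Gr m N) (x : E N) :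
    (rotate Q V).proj x = act Q (V.proj (act Q⁻¹ x)) := by
  refine Submodule.eq_starProjection_of_mem_of_inner_eq_zero (K := (rotate Q V).1)
    ⟨_, V.proj_mem _, rfl⟩ ?_
  rintro _ ⟨w, hw, rfl⟩
  have h := V.1.starProjection_inner_eq_zero (act Q⁻¹ x) w hw
  have h2 : ⟪act Q w, x - act Q (V.proj (act Q⁻¹ x))⟫_ℝ = 0 := by
    rw [inner_act, map_sub, act_inv_act, real_inner_comm]
    exact h
  rw [real_inner_comm]
  exact h2

theorem continuous_rotate {m N : ℕ} (V : Gr m N) : Continuous fun Q : O N => rotate Q V := by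
  refine continuous_induced_rng.2 (continuous_clm_apply.2 fun x => ?_)
  simp only [Function.comp_apply, proj_rotate]
  have h1 : Continuous fun Q : O N => V.proj (act Q⁻¹ x) :=
    V.proj.continuous.comp ((continuous_act x).comp continuous_inv)
  refine (PiLp.continuous_toLp 2 _).comp ?_
  exact Continuous.matrix_mulVec continuous_subtype_val ((PiLp.continuous_ofLp 2 _).comp h1)

/-- The span of the first `m` standard basis vectors of `ℝ^N`. -/
noncomputable def stdPlane {m N : ℕ} (h : m ≤ N) : Gr m N :=
  ⟨Submodule.span ℝ (Set.range fun i : Fin m =>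
    (EuclideanSpace.single (Fin.castLE h i) 1 : E N)), by
    have hl : LinearIndependent ℝ fun i : Fin m =>
        (EuclideanSpace.single (Fin.castLE h i) 1 : E N) :=
      ((EuclideanSpace.orthonormal_single (𝕜 := ℝ) (ι := Fin N)).comp (Fin.castLE h)
        (Fin.castLE_injective h)).linearIndependent
    simpa using finrank_span_eq_card hl⟩

/-- The uniform probability measure of `Gr(m,N)`: the law of `Q V₀` for a Haar distributed random
`Q ∈ O(N)` and a fixed plane `V₀`. -/
noncomputable def grMeasure {m N : ℕ} (h : m ≤ N) : MeasureTheory.Measure (Gr m N) :=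
  (haarO N).map fun Q => rotate Q (stdPlane h)

instance {m N : ℕ} (h : m ≤ N) : MeasureTheory.IsProbabilityMeasure (grMeasure h) :=
  MeasureTheory.Measure.isProbabilityMeasure_map (continuous_rotate _).measurable.aemeasurable

end AffGr

/-! Everything is read through orthogonal projections. A plane is known by its projection `P`, a
flat by `[P_A, b₀]`, and in both cases the charts are smooth functions of these data and conversely
(`IsSmoothCoordinate`). Since `b₀ ⊥ A`, the projection onto `j (A + b₀)` is `P_A` plus the
projection onto the line of `b₀ + e`, where `e = e_{n+1}`. This formula can be inverted smoothly
from `P e` wherever `P e ≠ 0` (`proj_j`, `jInvCoord_jProj`). Hence `j` is a diffeomorphism onto the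
open set of planes `W` with `e ∉ Wᗮ`.

The canonical metric is induced by the embedding `V ↦ P_V / √2` into matrices with the Frobenius
norm (`Gr.isInducedBy_grMetric`), so it is smooth, its pullback is induced by the composite with
`j`, and lengths of paths are lengths of curves of matrices, unchanged by conjugation with an
orthogonal matrix.

Since `j` preserves lengths, the distance in the Grassmannian is at most the one upstairs.
Conversely, take a path `γ` of nearly minimal length between `j S` and `j T`. It may leave the image
of `j`, but the union of the spaces `γ(t)ᗮ` has dimension at most `(n - k) + 1 < n + 1`, because `k
≥ 1` (`Gr.hausdorffMeasure_orthogonalUnion`). It is therefore a null cone, and `Q⁻¹ e` avoids it for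
almost every `Q` (`haarO_act_inv_mem_cone`). For such a `Q` close to `1`, the path `Q γ` stays in
the image, has the same length and has nearly the same endpoints. Finiteness holds because each
chart has a connected target and any two chart domains meet.

The statements about measures use the same null cone lemma with the single subspace `Vᗮ`, which is
proper; extrema exist because the Grassmannian is an orbit of the compact group `O(N)`. -/

namespace AffGr

/-! ### Riemannian metrics induced by maps into an inner product space. -/

section InducedMetric

open scoped Bundle

variable {F : Type*} [NormedAddCommGroup F] [NormedSpace ℝ F] {M : Type*}
  [TopologicalSpace M] [ChartedSpace F M] {H : Type*} [NormedAddCommGroup H] [InnerProductSpace ℝ H]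

/-- The differential of a map from a manifold to a vector space, with values in that space. -/
noncomputable def differential (f : M → H) (x : M) : TangentSpace 𝓘(ℝ, F) x →L[ℝ] H :=
  mfderiv 𝓘(ℝ, F) 𝓘(ℝ, H) f x

/-- The metric `g` is induced by the map `f` to an inner product space. -/
def IsInducedBy (g : Bundle.RiemannianMetric (fun x : M => TangentSpace 𝓘(ℝ, F) x)) (f : M → H) :
    Prop :=
  ∀ (x : M) (u v : TangentSpace 𝓘(ℝ, F) x),
    g.inner x u v = ⟪differential f x u, differential f x v⟫_ℝ

/-- A metric induced by a smooth map is smooth. -/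
theorem IsInducedBy.contMDiff [FiniteDimensional ℝ F] [IsManifold 𝓘(ℝ, F) ∞ M]
    {g : Bundle.RiemannianMetric (fun x : M => TangentSpace 𝓘(ℝ, F) x)} {f : M → H}
    (hg : IsInducedBy g f) (hf : ContMDiff 𝓘(ℝ, F) 𝓘(ℝ, H) ∞ f) :
    ContMDiff 𝓘(ℝ, F) (𝓘(ℝ, F).prod 𝓘(ℝ, F →L[ℝ] F →L[ℝ] ℝ)) ∞
      (fun x ↦ Bundle.TotalSpace.mk' (F →L[ℝ] F →L[ℝ] ℝ)
        (E := fun x : M => TangentSpace 𝓘(ℝ, F) x →L[ℝ] TangentSpace 𝓘(ℝ, F) x →L[ℝ] ℝ)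
        x (g.inner x)) := by
  intro x₀
  rw [contMDiffAt_hom_bundle]
  refine ⟨contMDiffAt_id, ?_⟩
  have h1 := (hf x₀).mfderiv_const (m := ∞) (by simp)
  -- In a trivialization the metric is the quadratic expression `A ↦ ⟪A ·, A ·⟫` evaluated at the
  -- differential of `f` in coordinates, and that differential is smooth by `h1`.
  have h2 : ContDiff ℝ ∞ fun A : F →L[ℝ] H => (innerSL ℝ (E := H)).bilinearComp A A := by
    refine contDiff_clm_apply_iff.2 fun v => contDiff_clm_apply_iff.2 fun w => ?_
    simp only [ContinuousLinearMap.bilinearComp_apply, innerSL_apply_apply]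
    exact (contDiff_id.clm_apply contDiff_const).inner ℝ (contDiff_id.clm_apply contDiff_const)
  refine (h2.contMDiff.contMDiffAt.comp x₀ h1).congr_of_eventuallyEq ?_
  have hb := (trivializationAt F (TangentSpace 𝓘(ℝ, F)) x₀).open_baseSet.mem_nhds
    (FiberBundle.mem_baseSet_trivializationAt' x₀)
  filter_upwards [hb] with x hx
  ext v w
  rw [inCoordinates_apply_eq₂ hx hx (Set.mem_univ _)]
  have key : ∀ u : F, inTangentCoordinates 𝓘(ℝ, F) 𝓘(ℝ, H) id f (mfderiv 𝓘(ℝ, F) 𝓘(ℝ, H) f) x₀ x u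
      = differential f x ((trivializationAt F (TangentSpace 𝓘(ℝ, F)) x₀).symm x u) := by
    intro u
    change (trivializationAt H (TangentSpace 𝓘(ℝ, H)) (f x₀)).continuousLinearMapAt ℝ (f x)
      (mfderiv 𝓘(ℝ, F) 𝓘(ℝ, H) f x
        ((trivializationAt F (TangentSpace 𝓘(ℝ, F)) x₀).symmL ℝ x u)) = _
    rw [TangentBundle.continuousLinearMapAt_model_space, ← Bundle.Trivialization.symmL_apply
      (R := ℝ) (trivializationAt F (TangentSpace 𝓘(ℝ, F)) x₀) hx u]
    rfl
  simp [key, hg x]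

/-- The metric induced by an immersion into an inner product space. -/
noncomputable def inducedMetric [FiniteDimensional ℝ F] (f : M → H)
    (hf : ∀ x : M, Function.Injective (differential (F := F) f x)) :
    Bundle.RiemannianMetric (fun x : M => TangentSpace 𝓘(ℝ, F) x) where
  inner x :=
    let A : F →L[ℝ] H := differential f x
    ((innerSL ℝ (E := H)).bilinearComp A A : F →L[ℝ] F →L[ℝ] ℝ)
  symm x v w := real_inner_comm _ _
  pos x v hv := real_inner_self_pos.2 fun h => hv (hf x (h.trans (map_zero _).symm))
  continuousAt x := by
    have h : Continuous fun v => ⟪differential (F := F) f x v, differential f x v⟫_ℝ :=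
      (differential f x).continuous.inner (differential f x).continuous
    exact h.continuousAt
  isVonNBounded x := by
    -- An injective linear map on a finite-dimensional space is bounded below, so the unit ball of
    -- the induced form lies in the ball of radius `K`.
    obtain ⟨K, -, hK⟩ := (LinearMap.injective_iff_antilipschitz
      (E := F) (F := H) (differential (F := F) f x).toLinearMap).1 (hf x)
    refine (NormedSpace.isVonNBounded_iff ℝ (E := F)).2 ?_
    refine (Metric.isBounded_closedBall (x := (0 : F)) (r := K)).subset fun v hv => ?_
    have h1 : ⟪differential (F := F) f x v, differential (F := F) f x v⟫_ℝ < 1 := hv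
    rw [real_inner_self_eq_norm_sq, sq_lt_one_iff₀ (norm_nonneg _)] at h1
    have h2 : ‖v‖ ≤ K * ‖differential (F := F) f x v‖ :=
      ZeroHomClass.bound_of_antilipschitz (E := F) (F := H)
        (differential (F := F) f x).toLinearMap hK v
    rw [mem_closedBall_zero_iff]
    exact h2.trans ((mul_le_mul_of_nonneg_left h1.le K.2).trans_eq (mul_one _))

theorem isInducedBy_inducedMetric [FiniteDimensional ℝ F] (f : M → H)
    (hf : ∀ x : M, Function.Injective (differential (F := F) f x)) :
    IsInducedBy (inducedMetric f hf) f := fun _ _ _ => rfl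

/-- By the chain rule the velocity of `f ∘ γ` is the differential of `f` applied to the velocity of
`γ`, and for an induced metric the differential preserves norms. -/
theorem IsInducedBy.pathELength_eq
    {g : Bundle.RiemannianMetric (fun x : M => TangentSpace 𝓘(ℝ, F) x)} {f : M → H}
    (hg : IsInducedBy g f) (hf : MDifferentiable 𝓘(ℝ, F) 𝓘(ℝ, H) f) {γ : ℝ → M} {a b : ℝ}
    (hγ : ∀ t ∈ Set.Ioo a b, MDifferentiableAt 𝓘(ℝ, ℝ) 𝓘(ℝ, F) γ t) :
    letI : Bundle.RiemannianBundle (fun x : M => TangentSpace 𝓘(ℝ, F) x) := ⟨g⟩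
    Manifold.pathELength 𝓘(ℝ, F) γ a b = ∫⁻ t in Set.Ioo a b, ‖deriv (f ∘ γ) t‖ₑ := by
  let : Bundle.RiemannianBundle (fun x : M => TangentSpace 𝓘(ℝ, F) x) := ⟨g⟩
  rw [Manifold.pathELength_eq_lintegral_mfderiv_Ioo]
  refine MeasureTheory.setLIntegral_congr_fun measurableSet_Ioo fun t ht => ?_
  have h1 : deriv (f ∘ γ) t = differential f (γ t) (mfderiv 𝓘(ℝ, ℝ) 𝓘(ℝ, F) γ t 1) := by
    have := mfderiv_comp t (hf (γ t)) (hγ t ht)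
    rw [mfderiv_eq_fderiv] at this
    rw [← fderiv_apply_one_eq_deriv, this]
    rfl
  have h2 : ∀ v : TangentSpace 𝓘(ℝ, F) (γ t), ‖v‖ = ‖differential f (γ t) v‖ := by
    intro v
    rw [norm_eq_sqrt_real_inner, norm_eq_sqrt_real_inner (F := H), ← hg]
    rfl
  rw [h1, ← ofReal_norm, ← ofReal_norm, h2]

end InducedMetric
end AffGr

namespace AffGr

/-! ### Smoothness of determinants and inverse matrices. -/

section SmoothMatrix

variable {H : Type*} [NormedAddCommGroup H] [NormedSpace ℝ H] {ι : Type*} [Fintype ι]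
  [DecidableEq ι] {s : Set H} {A : H → Matrix ι ι ℝ}

theorem contDiffOn_det (hA : ∀ i j, ContDiffOn ℝ ∞ (fun x => A x i j) s) :
    ContDiffOn ℝ ∞ (fun x => (A x).det) s := by
  simp only [Matrix.det_apply]
  exact ContDiffOn.sum fun σ _ => (contDiffOn_prod fun i _ => hA (σ i) i).const_smul _

theorem contDiffOn_matrix_inv (hA : ∀ i j, ContDiffOn ℝ ∞ (fun x => A x i j) s)
    (h0 : ∀ x ∈ s, (A x).det ≠ 0) (i j : ι) : ContDiffOn ℝ ∞ (fun x => (A x)⁻¹ i j) s := by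
  simp only [Matrix.inv_def, Ring.inverse_eq_inv', Matrix.smul_apply, smul_eq_mul,
    Matrix.adjugate_apply]
  -- Cramer's rule: the entry of the adjugate is the determinant of `A x` with row `j` replaced by a
  -- constant unit vector.
  refine ((contDiffOn_det hA).inv h0).mul (contDiffOn_det fun k l => ?_)
  by_cases hk : k = j
  · subst hk
    simp only [Matrix.updateRow_self]
    exact contDiffOn_const
  · simp only [Matrix.updateRow_ne hk]
    exact hA k l

end SmoothMatrix

/-! ### Smooth structures determined by extrinsic coordinates. -/

section Coordinates

variable {F : Type*} [NormedAddCommGroup F] [NormedSpace ℝ F] {M : Type*} [TopologicalSpace M]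
  [ChartedSpace F M] {W : Type*} [NormedAddCommGroup W] [NormedSpace ℝ W]

/-- The map `p` to a normed space is inducing, it is smooth in the charts, and the charts are
smooth functions of `p`. -/
structure IsSmoothCoordinate (p : M → W) : Prop where
  isInducing : Topology.IsInducing p
  contDiffOn_symm : ∀ e ∈ atlas F M, ContDiffOn ℝ ∞ (p ∘ e.symm) e.target
  exists_chart_eq : ∀ e ∈ atlas F M, ∃ (Φ : W → F) (U : Set W), IsOpen U ∧ ContDiffOn ℝ ∞ Φ U ∧
    ∀ x ∈ e.source, p x ∈ U ∧ e x = Φ (p x)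

namespace IsSmoothCoordinate

variable {p : M → W}

/-- A change of charts `e' ∘ e.symm` factors as `Φ ∘ (p ∘ e.symm)`, with both factors smooth. -/
theorem isManifold (hp : IsSmoothCoordinate (F := F) p) : IsManifold 𝓘(ℝ, F) ∞ M := by
  refine isManifold_of_contDiffOn _ _ _ fun e e' he he' => ?_
  obtain ⟨Φ, U, -, hΦ, hU⟩ := hp.exists_chart_eq e' he'
  have h : ContDiffOn ℝ ∞ (Φ ∘ p ∘ e.symm) (e.symm ≫ₕ e').source := by
    refine hΦ.comp ((hp.contDiffOn_symm e he).mono fun x hx => ?_) fun x hx => ?_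
    · exact hx.1
    · exact (hU _ hx.2).1
  simp only [modelWithCornersSelf_coe, modelWithCornersSelf_coe_symm, Set.range_id, Set.inter_univ,
    Set.preimage_id_eq, id_eq, Function.id_comp, Function.comp_id]
  exact h.congr fun x hx => (hU _ hx.2).2

theorem contMDiff [IsManifold 𝓘(ℝ, F) ∞ M] (hp : IsSmoothCoordinate (F := F) p) :
    ContMDiff 𝓘(ℝ, F) 𝓘(ℝ, W) ∞ p := by
  intro x
  have h1 := (hp.contDiffOn_symm _ (chart_mem_atlas F x)).contMDiffOn
  have h2 : ContMDiffOn 𝓘(ℝ, F) 𝓘(ℝ, F) ∞ (chartAt F x) (chartAt F x).source :=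
    contMDiffOn_chart
  have h3 := (h1.comp h2 fun y hy => (chartAt F x).map_source hy).contMDiffAt
    ((chartAt F x).open_source.mem_nhds (mem_chart_source F x))
  refine h3.congr_of_eventuallyEq ?_
  filter_upwards [(chartAt F x).open_source.mem_nhds (mem_chart_source F x)] with y hy
  simp [(chartAt F x).left_inv hy]

/-- Smoothness into `M` can be tested after `p`: continuity because `p` is inducing, and smoothness
because the chart at `f x` is a smooth function `Φ` of `p`. No rank condition on `p` is needed. -/
theorem contMDiffAt_of_comp {F' : Type*} [NormedAddCommGroup F'] [NormedSpace ℝ F'] {M' : Type*}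
    [TopologicalSpace M'] [ChartedSpace F' M'] (hp : IsSmoothCoordinate (F := F) p) {f : M' → M}
    {x : M'} {n : ℕ∞ω} (hn : n ≤ ∞) (hf : ContMDiffAt 𝓘(ℝ, F') 𝓘(ℝ, W) n (p ∘ f) x) :
    ContMDiffAt 𝓘(ℝ, F') 𝓘(ℝ, F) n f x := by
  have hc : ContinuousAt f x := hp.isInducing.continuousAt_iff.2 hf.continuousAt
  refine contMDiffAt_iff_target.2 ⟨hc, ?_⟩
  obtain ⟨Φ, U, hUo, hΦ, hU⟩ := hp.exists_chart_eq _ (chart_mem_atlas F (f x))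
  have h1 : ContMDiffAt 𝓘(ℝ, W) 𝓘(ℝ, F) n Φ ((p ∘ f) x) :=
    ((hΦ.of_le hn).contDiffAt
      (hUo.mem_nhds (hU _ (mem_chart_source F (f x))).1)).contMDiffAt
  refine (h1.comp x hf).congr_of_eventuallyEq ?_
  filter_upwards [hc ((chartAt F (f x)).open_source.mem_nhds (mem_chart_source F (f x)))] with y hy
  simpa using (hU _ hy).2

end IsSmoothCoordinate

end Coordinates

/-! ### The smooth structure of the Grassmannian. -/

namespace Gr

variable {m N : ℕ}

/-- The coordinates, in the chart centred at `V`, of the plane with orthogonal projection `P`. -/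
noncomputable def coord (V : Gr m N) (P : E N →L[ℝ] E N) : GrModel m N :=
  WithLp.toLp 2 fun p =>
    ((Matrix.of fun (i : Fin (N - m)) (l : Fin m) => ⟪V.Z i, P (V.Y l)⟫_ℝ) *
      (Matrix.of fun i l => ⟪V.Y i, P (V.Y l)⟫_ℝ)⁻¹) p.1 p.2

/-- The projections onto the planes in the domain of the chart centred at `V` are in this set. -/
def coordDomain (V : Gr m N) : Set (E N →L[ℝ] E N) :=
  {P | (Matrix.of fun i l => ⟪V.Y i, P (V.Y l)⟫_ℝ).det ≠ 0}

theorem contDiff_inner_apply (x y : E N) :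
    ContDiff ℝ ∞ fun P : E N →L[ℝ] E N => ⟪x, P y⟫_ℝ :=
  contDiff_const.inner ℝ (contDiff_id.clm_apply contDiff_const)

theorem isOpen_coordDomain (V : Gr m N) : IsOpen V.coordDomain := by
  have h : ContDiffOn ℝ ∞ (fun P : E N →L[ℝ] E N =>
      (Matrix.of fun i l => ⟪V.Y i, P (V.Y l)⟫_ℝ).det) Set.univ :=
    contDiffOn_det fun i l => (contDiff_inner_apply _ _).contDiffOn
  exact isOpen_ne_fun (continuousOn_univ.1 h.continuousOn) continuous_const

theorem contDiffOn_coord (V : Gr m N) : ContDiffOn ℝ ∞ V.coord V.coordDomain := by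
  refine contDiffOn_euclidean.2 fun p => ?_
  simp only [coord, Matrix.mul_apply, Matrix.of_apply]
  refine ContDiffOn.sum fun l _ => (contDiff_inner_apply _ _).contDiffOn.mul ?_
  exact contDiffOn_matrix_inv (fun i l => (contDiff_inner_apply _ _).contDiffOn)
    (fun P hP => hP) l p.2

theorem contDiff_graphVec (V : Gr m N) (l : Fin m) :
    ContDiff ℝ ∞ fun x : GrModel m N => V.graphVec (Matrix.of fun i j => x (i, j)) l := by
  unfold graphVec
  simp only [Matrix.of_apply]
  fun_prop

/-- With `M = Y + Z X` the projection is `M (Mᵀ M)⁻¹ Mᵀ`. The Gram matrix is invertible for every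
`X`, so there is no restriction on the domain. -/
theorem contDiff_proj_graph (V : Gr m N) :
    ContDiff ℝ ∞ fun x : GrModel m N => (V.graph (Matrix.of fun i j => x (i, j))).proj := by
  refine contDiff_clm_apply_iff.2 fun y => ?_
  simp only [proj_graph_apply]
  have h1 : ∀ l l', ContDiff ℝ ∞ fun x : GrModel m N =>
      (V.gram (Matrix.of fun i j => x (i, j)))⁻¹ l l' := fun l l' =>
    contDiffOn_univ.1 (contDiffOn_matrix_inv (fun i j =>
      ((V.contDiff_graphVec i).inner ℝ (V.contDiff_graphVec j)).contDiffOn)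
      (fun x _ => V.det_gram _) l l')
  have h2 : ∀ l, ContDiff ℝ ∞ fun x : GrModel m N =>
      ∑ l', (V.gram (Matrix.of fun i j => x (i, j)))⁻¹ l l' *
        ⟪V.graphVec (Matrix.of fun i j => x (i, j)) l', y⟫_ℝ := fun l =>
    ContDiff.sum fun l' _ => (h1 l l').mul ((V.contDiff_graphVec l').inner ℝ contDiff_const)
  exact ContDiff.sum fun l _ => (h2 l).smul (V.contDiff_graphVec l)

theorem isSmoothCoordinate_proj :
    IsSmoothCoordinate (F := GrModel m N) (proj : Gr m N → E N →L[ℝ] E N) where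
  isInducing := ⟨rfl⟩
  contDiffOn_symm := by
    rintro _ ⟨V, rfl⟩
    exact V.contDiff_proj_graph.contDiffOn
  exists_chart_eq := by
    rintro _ ⟨V, rfl⟩
    exact ⟨V.coord, V.coordDomain, V.isOpen_coordDomain, V.contDiffOn_coord,
      fun W hW => ⟨hW, rfl⟩⟩

instance : IsManifold 𝓘(ℝ, GrModel m N) ∞ (Gr m N) := isSmoothCoordinate_proj.isManifold

theorem contMDiff_proj :
    ContMDiff 𝓘(ℝ, GrModel m N) 𝓘(ℝ, E N →L[ℝ] E N) ∞ (proj : Gr m N → _) :=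
  isSmoothCoordinate_proj.contMDiff

theorem proj_injective : Function.Injective (proj : Gr m N → E N →L[ℝ] E N) :=
  fun _ _ h => Subtype.ext (Submodule.starProjection_inj.1 h)

instance : T2Space (Gr m N) := T2Space.of_injective_continuous proj_injective continuous_proj

instance : SecondCountableTopology (Gr m N) :=
  isSmoothCoordinate_proj.isInducing.secondCountableTopology

end Gr

/-! ### The smooth structure of the affine Grassmannian. -/

namespace Graff

variable {k n : ℕ}

theorem projCoord_injective : Function.Injective (projCoord : Graff k n → _) := by
  intro S T h
  have h1 : S.dir = T.dir := Gr.proj_injective (congrArg Prod.fst h)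
  have h2 : S.foot = T.foot := congrArg Prod.snd h
  exact ext_foot h1 S.foot_mem (h2 ▸ T.foot_mem)

/-- The coordinates, in the chart centred at `S`, of the flat with given projection affine
coordinates. -/
noncomputable def coord (S : Graff k n) (q : (E n →L[ℝ] E n) × E n) : GraffModel k n :=
  WithLp.toLp 2 fun p => Fin.lastCases (motive := fun _ => ℝ)
    (⟪S.dir.Z p.1, q.2 - S.foot⟫_ℝ - ∑ l, S.dir.coord q.1 (p.1, l) * ⟪S.dir.Y l, q.2⟫_ℝ)
    (fun l => S.dir.coord q.1 (p.1, l)) p.2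

theorem contDiffOn_coord (S : Graff k n) :
    ContDiffOn ℝ ∞ S.coord (Prod.fst ⁻¹' S.dir.coordDomain) := by
  have h : ∀ i l, ContDiffOn ℝ ∞ (fun q : (E n →L[ℝ] E n) × E n => S.dir.coord q.1 (i, l))
      (Prod.fst ⁻¹' S.dir.coordDomain) := fun i l =>
    (contDiffOn_euclidean.1 S.dir.contDiffOn_coord (i, l)).comp contDiff_fst.contDiffOn
      fun _ h => h
  refine contDiffOn_euclidean.2 ?_
  rintro ⟨i, l⟩
  refine Fin.lastCases ?_ (fun l => ?_) l
  · simp only [coord, Fin.lastCases_last]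
    refine ContDiffOn.sub ?_ (ContDiffOn.sum fun l _ => (h i l).mul ?_)
    · exact (contDiff_const.inner ℝ (contDiff_snd.sub contDiff_const)).contDiffOn
    · exact (contDiff_const.inner ℝ contDiff_snd).contDiffOn
  · simpa only [coord, Fin.lastCases_castSucc] using h i l

theorem isSmoothCoordinate_projCoord :
    IsSmoothCoordinate (F := GraffModel k n) (projCoord : Graff k n → _) where
  isInducing := ⟨rfl⟩
  contDiffOn_symm := by
    rintro _ ⟨S, rfl⟩
    refine ContDiff.contDiffOn ?_
    have hg : ContDiff ℝ ∞ fun x : GraffModel k n =>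
        (S.dir.graph (Matrix.of fun i j => x (i, j.castSucc))).proj := by
      have h : ContDiff ℝ ∞ fun x : GraffModel k n =>
          (WithLp.toLp 2 fun p : Fin (n - k) × Fin k => x (p.1, p.2.castSucc) : GrModel k n) :=
        contDiff_euclidean.2 fun p => by fun_prop
      have h' := S.dir.contDiff_proj_graph.comp h
      simp only [Function.comp_def] at h'
      exact h'
    have hp : ContDiff ℝ ∞ fun x : GraffModel k n => S.shift fun i => x (i, Fin.last k) := by
      unfold shift
      fun_prop
    have e : projCoord ∘ S.chart.symm = fun x : GraffModel k n =>
        ((S.dir.graph (Matrix.of fun i j => x (i, j.castSucc))).proj,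
          (S.shift fun i => x (i, Fin.last k)) -
            (S.dir.graph (Matrix.of fun i j => x (i, j.castSucc))).proj
              (S.shift fun i => x (i, Fin.last k))) := by
      funext x
      change projCoord (mk _ _) = _
      rw [projCoord, dir_mk, foot_mk]
    rw [e]
    exact hg.prodMk (hp.sub (hg.clm_apply hp))
  exists_chart_eq := by
    rintro _ ⟨S, rfl⟩
    exact ⟨S.coord, Prod.fst ⁻¹' S.dir.coordDomain, S.dir.isOpen_coordDomain.preimage
      continuous_fst, S.contDiffOn_coord, fun W hW => ⟨hW, rfl⟩⟩

instance : IsManifold 𝓘(ℝ, GraffModel k n) ∞ (Graff k n) := isSmoothCoordinate_projCoord.isManifold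

theorem contMDiff_projCoord :
    ContMDiff 𝓘(ℝ, GraffModel k n) 𝓘(ℝ, (E n →L[ℝ] E n) × E n) ∞ (projCoord : Graff k n → _) :=
  isSmoothCoordinate_projCoord.contMDiff

instance : T2Space (Graff k n) :=
  T2Space.of_injective_continuous projCoord_injective continuous_projCoord

instance : SecondCountableTopology (Graff k n) :=
  isSmoothCoordinate_projCoord.isInducing.secondCountableTopology

end Graff

end AffGr

namespace AffGr

/-! ### The splitting of `ℝ^(n+1)` into `ℝ^n` and the last coordinate. -/

section Inclusion

variable {n : ℕ}

/-- The inclusion of `ℝ^n` in `ℝ^(n+1)` as a continuous linear map. -/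
noncomputable def inclL (n : ℕ) : E n →L[ℝ] E (n + 1) := LinearMap.toContinuousLinearMap (incl n)

/-- The map `ℝ^(n+1) → ℝ^n` that forgets the last coordinate. -/
noncomputable def restr (n : ℕ) : E (n + 1) →L[ℝ] E n := LinearMap.toContinuousLinearMap
  { toFun := fun x => WithLp.toLp 2 fun i => x i.castSucc
    map_add' := fun x y => by ext i; simp
    map_smul' := fun c x => by ext i; simp }

theorem inclL_apply (x : E n) : inclL n x = incl n x := rfl

theorem restr_apply (x : E (n + 1)) (i : Fin n) : restr n x i = x i.castSucc := rfl

theorem restr_inclL (x : E n) : restr n (inclL n x) = x := by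
  ext i; rw [restr_apply, inclL_apply, incl_castSucc]

theorem restr_eLast : restr n (eLast n) = 0 := by
  ext i; simp [restr_apply, eLast, Fin.castSucc_ne_last]

theorem inner_inclL_left (x : E n) (y : E (n + 1)) : ⟪inclL n x, y⟫_ℝ = ⟪x, restr n y⟫_ℝ := by
  simp [PiLp.inner_apply, Fin.sum_univ_castSucc, inclL_apply, incl_castSucc, incl_last,
    restr_apply]

theorem inner_inclL_right (x : E n) (y : E (n + 1)) : ⟪y, inclL n x⟫_ℝ = ⟪restr n y, x⟫_ℝ := by
  rw [real_inner_comm, inner_inclL_left, real_inner_comm]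

theorem inner_eLast_self : ⟪eLast n, eLast n⟫_ℝ = 1 := by
  simp [eLast]

theorem inner_eLast_left (x : E (n + 1)) : ⟪eLast n, x⟫_ℝ = x (Fin.last n) := by
  simp [eLast, EuclideanSpace.inner_single_left]

theorem inclL_restr_add (x : E (n + 1)) :
    inclL n (restr n x) + ⟪eLast n, x⟫_ℝ • eLast n = x := by
  ext i
  refine Fin.lastCases ?_ (fun i => ?_) i
  · simp [inclL_apply, incl_last, inner_eLast_left, eLast_last]
  · simp [inclL_apply, incl_castSucc, restr_apply, eLast, Fin.castSucc_ne_last]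

end Inclusion

/-! ### The embedding `j` in terms of projections, and its inverse. -/

section Embedding

variable {k n : ℕ}

/-- The point `b + e_{n+1}`. -/
noncomputable def raise (b : E n) : E (n + 1) := inclL n b + eLast n

theorem restr_raise (b : E n) : restr n (raise b) = b := by
  rw [raise, map_add, restr_inclL, restr_eLast, add_zero]

theorem inner_eLast_raise (b : E n) : ⟪eLast n, raise b⟫_ℝ = 1 := by
  rw [raise, inner_add_right, inner_inclL_right, restr_eLast, inner_zero_left, inner_eLast_self,
    zero_add]

theorem inner_raise_self_ne_zero (b : E n) : ⟪raise b, raise b⟫_ℝ ≠ 0 := by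
  intro h
  have := inner_eLast_raise b
  rw [inner_self_eq_zero.1 h, inner_zero_right] at this
  exact zero_ne_one this

theorem contDiff_raise : ContDiff ℝ ∞ (raise : E n → E (n + 1)) :=
  (inclL n).contDiff.add contDiff_const

/-- The orthogonal projection onto `j (A + b)` in terms of the projection affine coordinates. -/
noncomputable def jProj (q : (E n →L[ℝ] E n) × E n) : E (n + 1) →L[ℝ] E (n + 1) :=
  inclL n ∘L q.1 ∘L restr n +
    (⟪raise q.2, raise q.2⟫_ℝ)⁻¹ • (innerSL ℝ (raise q.2)).smulRight (raise q.2)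

theorem jProj_apply (q : (E n →L[ℝ] E n) × E n) (x : E (n + 1)) :
    jProj q x = inclL n (q.1 (restr n x)) +
      (⟪raise q.2, raise q.2⟫_ℝ)⁻¹ • ⟪raise q.2, x⟫_ℝ • raise q.2 := rfl

theorem contDiff_jProj : ContDiff ℝ ∞ (jProj : (E n →L[ℝ] E n) × E n → _) := by
  refine contDiff_clm_apply_iff.2 fun x => ?_
  simp only [jProj_apply]
  have h : ContDiff ℝ ∞ fun q : (E n →L[ℝ] E n) × E n => raise q.2 :=
    contDiff_raise.comp contDiff_snd
  refine ((inclL n).contDiff.comp (contDiff_fst.clm_apply contDiff_const)).add ?_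
  exact ((h.inner ℝ h).inv fun q => inner_raise_self_ne_zero q.2).smul
    ((h.inner ℝ contDiff_const).smul h)

/-- With the foot as base point, `b₀ + e_{n+1}` is orthogonal to the linear part, so the two
generators of `j S` split orthogonally and their projections add. -/
theorem proj_j (S : Graff k n) : (j S).proj = jProj S.projCoord := by
  ext1 x
  have hj := j_eq S S.foot_mem
  have hle : ∀ a ∈ S.dir.1, inclL n a ∈ (j S).1 := fun a ha => by
    rw [hj]; exact Submodule.subset_span (Or.inl ⟨a, ha, rfl⟩)
  have hr : raise S.foot ∈ (j S).1 := by
    rw [hj]; exact Submodule.subset_span (Or.inr rfl)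
  refine Submodule.eq_starProjection_of_mem_of_inner_eq_zero (K := (j S).1) ?_ ?_
  · rw [jProj_apply]
    exact Submodule.add_mem _ (hle _ (S.dir.proj_mem _))
      (Submodule.smul_mem _ _ (Submodule.smul_mem _ _ hr))
  · intro y hy
    rw [hj, lift] at hy
    induction hy using Submodule.span_induction with
    | zero => simp
    | add y z _ _ h1 h2 => rw [inner_add_right, h1, h2, add_zero]
    | smul c y _ h => rw [inner_smul_right, h, mul_zero]
    | mem y hy =>
      have hp := S.dir.1.starProjection_inner_eq_zero (restr n x)
      rcases hy with ⟨a, ha, rfl⟩ | rfl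
      · have h1 : ⟪S.foot, a⟫_ℝ = 0 := by rw [real_inner_comm]; exact S.inner_foot ha
        have h2 : ⟪restr n x, a⟫_ℝ = ⟪S.dir.proj (restr n x), a⟫_ℝ := by
          have := hp a ha
          rw [inner_sub_left] at this
          exact sub_eq_zero.1 this
        rw [← inclL_apply, jProj_apply, inner_inclL_right]
        simp [inner_sub_left, inner_add_left, restr_inclL, restr_raise, Graff.projCoord,
          inner_smul_left, h1, h2]
      · have h1 : ⟪S.dir.proj (restr n x), S.foot⟫_ℝ = 0 := S.inner_foot (S.dir.proj_mem _)
        change ⟪x - jProj S.projCoord x, raise S.foot⟫_ℝ = 0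
        rw [jProj_apply, inner_sub_left, inner_add_left, inner_inclL_left, restr_raise,
          inner_smul_left, inner_smul_left]
        simp only [Graff.projCoord, h1, zero_add, conj_trivial]
        rw [mul_comm, mul_assoc, mul_inv_cancel₀ (inner_raise_self_ne_zero _), mul_one,
          real_inner_comm, sub_self]

/-- The projection affine coordinates of a flat in terms of the orthogonal projection onto its image
under `j`. -/
noncomputable def jInvCoord (P : E (n + 1) →L[ℝ] E (n + 1)) : (E n →L[ℝ] E n) × E n :=
  (restr n ∘L (P - (⟪eLast n, P (eLast n)⟫_ℝ)⁻¹ •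
    (innerSL ℝ (P (eLast n))).smulRight (P (eLast n))) ∘L inclL n,
    (⟪eLast n, P (eLast n)⟫_ℝ)⁻¹ • restr n (P (eLast n)))

theorem jProj_eLast (q : (E n →L[ℝ] E n) × E n) :
    jProj q (eLast n) = (⟪raise q.2, raise q.2⟫_ℝ)⁻¹ • raise q.2 := by
  rw [jProj_apply, restr_eLast, map_zero, map_zero, zero_add,
    real_inner_comm (eLast n), inner_eLast_raise, one_smul]

theorem inner_eLast_jProj (q : (E n →L[ℝ] E n) × E n) :
    ⟪eLast n, jProj q (eLast n)⟫_ℝ = (⟪raise q.2, raise q.2⟫_ℝ)⁻¹ := by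
  rw [jProj_eLast, inner_smul_right, inner_eLast_raise, mul_one]

/-- Write `r = raise q.2` and `e = e_{n+1}`. Then `P e = r / |r|²` and `⟪e, P e⟫ = 1 / |r|²`.
Dividing `P e` by this number recovers `r`, and the rank-one term built from `P e` is the projection
onto the line of `r`; removing it leaves `q.1`. -/
theorem jInvCoord_jProj (q : (E n →L[ℝ] E n) × E n) : jInvCoord (jProj q) = q := by
  have h := inner_raise_self_ne_zero q.2
  rw [jInvCoord, inner_eLast_jProj, jProj_eLast, inv_inv]
  refine Prod.ext ?_ ?_
  · ext1 x
    simp only [ContinuousLinearMap.comp_apply, sub_apply, jProj_apply,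
      smul_apply, ContinuousLinearMap.smulRight_apply, innerSL_apply_apply,
      inner_smul_left, conj_trivial, smul_smul]
    rw [show ⟪raise q.2, raise q.2⟫_ℝ * ((⟪raise q.2, raise q.2⟫_ℝ)⁻¹ * ⟪raise q.2, inclL n x⟫_ℝ *
      (⟪raise q.2, raise q.2⟫_ℝ)⁻¹) = (⟪raise q.2, raise q.2⟫_ℝ)⁻¹ * ⟪raise q.2, inclL n x⟫_ℝ by
        field_simp, add_sub_cancel_right, restr_inclL, restr_inclL]
  · simp only [map_smul, restr_raise, smul_smul, mul_inv_cancel₀ h, one_smul]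

theorem contDiffAt_jInvCoord {P : E (n + 1) →L[ℝ] E (n + 1)} (h : ⟪eLast n, P (eLast n)⟫_ℝ ≠ 0) :
    ContDiffAt ℝ ∞ jInvCoord P := by
  have h1 : ContDiffAt ℝ ∞ (fun P : E (n + 1) →L[ℝ] E (n + 1) => P (eLast n)) P :=
    (contDiff_id.clm_apply contDiff_const).contDiffAt
  have h2 : ContDiffAt ℝ ∞ (fun P : E (n + 1) →L[ℝ] E (n + 1) => (⟪eLast n, P (eLast n)⟫_ℝ)⁻¹) P :=
    (contDiffAt_const.inner ℝ h1).inv h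
  refine ContDiffAt.prodMk ?_ (h2.smul ((restr n).contDiff.contDiffAt.comp P h1))
  have h3 : ContDiffAt ℝ ∞ (fun P : E (n + 1) →L[ℝ] E (n + 1) => P - (⟪eLast n, P (eLast n)⟫_ℝ)⁻¹ •
      (innerSL ℝ (P (eLast n))).smulRight (P (eLast n))) P :=
    contDiffAt_id.sub (h2.smul ((((innerSL ℝ).contDiff.contDiffAt).comp P h1).smulRight h1))
  exact contDiffAt_const.clm_comp (h3.clm_comp contDiffAt_const)

theorem jInvCoord_proj_j (S : Graff k n) : jInvCoord (j S).proj = S.projCoord := by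
  rw [proj_j, jInvCoord_jProj]

theorem j_injective : Function.Injective (j : Graff k n → Gr (k + 1) (n + 1)) := fun S T h =>
  Graff.projCoord_injective (by rw [← jInvCoord_proj_j, h, jInvCoord_proj_j])

/-- The linear part is `W ∩ ℝ^n`, and the base point is the projection of `e_{n+1}` rescaled to have
last coordinate `1`. -/
theorem exists_j_eq {W : Gr (k + 1) (n + 1)} (h : ⟪eLast n, W.proj (eLast n)⟫_ℝ ≠ 0) :
    ∃ S : Graff k n, j S = W := by
  set w := W.proj (eLast n) with hw
  set s := ⟪eLast n, w⟫_ℝ with hs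
  set A : Submodule ℝ (E n) := W.1.comap (incl n) with hA
  set b : E n := s⁻¹ • restr n w with hb
  have hwW : w ∈ W.1 := W.proj_mem _
  have hraise : incl n b + eLast n = s⁻¹ • w := by
    rw [← inclL_apply, hb, map_smul]
    conv_rhs => rw [← inclL_restr_add w]
    rw [smul_add, smul_smul, inv_mul_cancel₀ h, one_smul]
  have hlift : lift A b = W.1 := by
    refine le_antisymm ?_ fun x hx => ?_
    · refine Submodule.span_le.2 (Set.union_subset ?_ ?_)
      · rintro _ ⟨a, ha, rfl⟩
        exact ha
      · rintro _ rfl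
        rw [hraise]
        exact Submodule.smul_mem _ _ hwW
    -- Subtracting the multiple of `b + e_{n+1}` with the same last coordinate moves `x` into `W ∩
    -- ℝ^n`.
    · have h1 : x = incl n (restr n x - ⟪eLast n, x⟫_ℝ • b) +
          ⟪eLast n, x⟫_ℝ • (incl n b + eLast n) := by
        nth_rw 1 [← inclL_restr_add x]
        rw [map_sub, map_smul, smul_add, ← inclL_apply]
        abel
      have h2 : restr n x - ⟪eLast n, x⟫_ℝ • b ∈ A := by
        change incl n _ ∈ W.1
        rw [eq_sub_of_add_eq h1.symm, hraise]
        exact Submodule.sub_mem _ hx (Submodule.smul_mem _ _ (Submodule.smul_mem _ _ hwW))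
      rw [h1]
      exact Submodule.add_mem _ (Submodule.subset_span (Or.inl ⟨_, h2, rfl⟩))
        (Submodule.smul_mem _ _ (Submodule.subset_span (Or.inr rfl)))
  have hrank : Module.finrank ℝ A = k := by
    have h1 := finrank_lift A b
    rw [hlift, W.2] at h1
    omega
  let V : Gr k n := ⟨A, hrank⟩
  refine ⟨Graff.mk V b, Subtype.ext ?_⟩
  rw [j_eq _ (Graff.mem_mk V b)]
  exact (congrArg (fun D => lift D b) (AffineSubspace.direction_mk' b A)).trans hlift

theorem range_j :
    Set.range (j : Graff k n → Gr (k + 1) (n + 1)) = {W | ⟪eLast n, W.proj (eLast n)⟫_ℝ ≠ 0} := by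
  refine Set.Subset.antisymm ?_ fun W hW => exists_j_eq hW
  rintro _ ⟨S, rfl⟩
  change _ ≠ _
  rw [proj_j, inner_eLast_jProj]
  exact inv_ne_zero (inner_raise_self_ne_zero _)

/-- For an orthogonal projection `⟪e, P e⟫ = |P e|²`, which vanishes exactly when `e` is orthogonal
to the plane. This form of the condition turns avoidance of the complement into avoidance of a cone.
-/
theorem mem_range_j_iff {W : Gr (k + 1) (n + 1)} :
    W ∈ Set.range (j : Graff k n → Gr (k + 1) (n + 1)) ↔ eLast n ∉ W.1ᗮ := by
  rw [range_j, ← Submodule.starProjection_apply_eq_zero_iff]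
  change ¬ _ ↔ ¬ _
  have h : ⟪eLast n, W.proj (eLast n)⟫_ℝ = ⟪W.proj (eLast n), W.proj (eLast n)⟫_ℝ := by
    have := W.1.starProjection_inner_eq_zero (eLast n) _ (W.proj_mem (eLast n))
    rw [inner_sub_left] at this
    exact sub_eq_zero.1 this
  rw [h, inner_self_eq_zero]
  rfl

theorem isOpen_range_j : IsOpen (Set.range (j : Graff k n → Gr (k + 1) (n + 1))) := by
  rw [range_j]
  exact isOpen_ne_fun (continuous_const.inner (Gr.continuous_proj.clm_apply continuous_const))
    continuous_const

theorem contMDiff_j :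
    ContMDiff 𝓘(ℝ, GraffModel k n) 𝓘(ℝ, GrModel (k + 1) (n + 1)) ∞
      (j : Graff k n → Gr (k + 1) (n + 1)) := by
  intro S
  refine Gr.isSmoothCoordinate_proj.contMDiffAt_of_comp le_rfl ?_
  have h : (Gr.proj ∘ j : Graff k n → _) = jProj ∘ Graff.projCoord := funext proj_j
  rw [h]
  exact (contDiff_jProj.contMDiff.comp Graff.contMDiff_projCoord) S

/-- The embedding `j` as a diffeomorphism onto its range. -/
noncomputable def jDiffeo [Nonempty (Graff k n)] :
    PartialDiffeomorph 𝓘(ℝ, GraffModel k n) 𝓘(ℝ, GrModel (k + 1) (n + 1)) (Graff k n)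
      (Gr (k + 1) (n + 1)) ∞ where
  toFun := j
  invFun := Function.invFun j
  source := Set.univ
  target := Set.range j
  map_source' S _ := ⟨S, rfl⟩
  map_target' _ _ := Set.mem_univ _
  left_inv' S _ := Function.leftInverse_invFun j_injective S
  right_inv' W hW := Function.invFun_eq hW
  open_source := isOpen_univ
  open_target := isOpen_range_j
  contMDiffOn_toFun := contMDiff_j.contMDiffOn
  contMDiffOn_invFun := by
    intro W hW
    refine ContMDiffAt.contMDiffWithinAt ?_
    -- In projection coordinates the inverse of `j` is `jInvCoord`, smooth near `W` because its
    -- denominator does not vanish on the range of `j`.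
    refine Graff.isSmoothCoordinate_projCoord.contMDiffAt_of_comp le_rfl ?_
    have h1 : ContMDiffAt 𝓘(ℝ, GrModel (k + 1) (n + 1)) 𝓘(ℝ, (E n →L[ℝ] E n) × E n) ∞
        (jInvCoord ∘ Gr.proj) W := by
      rw [range_j] at hW
      exact (contDiffAt_jInvCoord hW).contMDiffAt.comp W (Gr.contMDiff_proj W)
    refine h1.congr_of_eventuallyEq ?_
    filter_upwards [isOpen_range_j.mem_nhds hW] with V hV
    rw [Function.comp_apply, Function.comp_apply, ← jInvCoord_proj_j, Function.invFun_eq hV]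

theorem isLocalDiffeomorph_j :
    IsLocalDiffeomorph 𝓘(ℝ, GraffModel k n) 𝓘(ℝ, GrModel (k + 1) (n + 1)) ∞
      (j : Graff k n → Gr (k + 1) (n + 1)) := fun S =>
  haveI : Nonempty (Graff k n) := ⟨S⟩
  ⟨jDiffeo, Set.mem_univ _, fun _ _ => rfl⟩

theorem isOpenEmbedding_j : Topology.IsOpenEmbedding (j : Graff k n → Gr (k + 1) (n + 1)) :=
  .of_continuous_injective_isOpenMap contMDiff_j.continuous j_injective
    isLocalDiffeomorph_j.isOpenMap

end Embedding

end AffGr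

namespace AffGr

/-! ### The rescaled Frobenius inner product and its invariance. -/

section Frobenius

variable {N : ℕ}

/-- The matrix of an operator, divided by `√2`, as a vector of a Euclidean space. -/
noncomputable def frob (N : ℕ) : (E N →L[ℝ] E N) →L[ℝ] EuclideanSpace ℝ (Fin N × Fin N) :=
  LinearMap.toContinuousLinearMap
    { toFun := fun P => WithLp.toLp 2 fun p =>
        (√2)⁻¹ * ⟪EuclideanSpace.single p.1 (1 : ℝ), P (EuclideanSpace.single p.2 1)⟫_ℝ
      map_add' := fun P Q => by ext p; simp [inner_add_right, mul_add]
      map_smul' := fun c P => by ext p; simp [inner_smul_right]; ring }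

theorem frob_apply (P : E N →L[ℝ] E N) (p : Fin N × Fin N) : frob N P p =
    (√2)⁻¹ * ⟪EuclideanSpace.single p.1 (1 : ℝ), P (EuclideanSpace.single p.2 1)⟫_ℝ := rfl

theorem sum_inner_apply_apply {ι : Type*} [Fintype ι] (b : OrthonormalBasis ι ℝ (E N))
    (P Q : E N →L[ℝ] E N) : ∑ i, ⟪P (b i), Q (b i)⟫_ℝ =
      LinearMap.trace ℝ (E N) ((ContinuousLinearMap.adjoint P ∘L Q : E N →L[ℝ] E N)) := by
  rw [LinearMap.trace_eq_sum_inner _ b]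
  refine Finset.sum_congr rfl fun i _ => ?_
  exact (ContinuousLinearMap.adjoint_inner_right P (b i) (Q (b i))).symm

/-- The sum is the trace of `P* Q`, hence independent of the basis; this allows computing in a basis
adapted to a plane. -/
theorem inner_frob {ι : Type*} [Fintype ι] (b : OrthonormalBasis ι ℝ (E N))
    (P Q : E N →L[ℝ] E N) : ⟪frob N P, frob N Q⟫_ℝ = 2⁻¹ * ∑ i, ⟪P (b i), Q (b i)⟫_ℝ := by
  rw [sum_inner_apply_apply, ← sum_inner_apply_apply (EuclideanSpace.basisFun (Fin N) ℝ)]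
  have h2 : (√2)⁻¹ * (√2)⁻¹ = (2 : ℝ)⁻¹ := by
    rw [← mul_inv, Real.mul_self_sqrt zero_le_two]
  rw [PiLp.inner_apply, Fintype.sum_prod_type_right, Finset.mul_sum]
  refine Finset.sum_congr rfl fun i _ => ?_
  rw [PiLp.inner_apply, Finset.mul_sum]
  refine Finset.sum_congr rfl fun l _ => ?_
  simp only [frob_apply, EuclideanSpace.inner_single_left, EuclideanSpace.basisFun_apply,
    RCLike.inner_apply, conj_trivial, one_mul]
  rw [← h2]
  ring

/-- The isometry of `ℝ^N` given by an orthogonal matrix. -/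
noncomputable def actIso (Q : O N) : E N ≃ₗᵢ[ℝ] E N where
  toFun := act Q
  map_add' := map_add _
  map_smul' := map_smul _
  invFun := act Q⁻¹
  left_inv := act_inv_act Q
  right_inv x := by simpa using act_inv_act Q⁻¹ x
  norm_map' x := by
    change ‖act Q x‖ = ‖x‖
    rw [norm_eq_sqrt_real_inner, inner_act, act_inv_act, ← norm_eq_sqrt_real_inner]

theorem actIso_apply (Q : O N) (x : E N) : actIso Q x = act Q x := rfl

/-- The left factor `Q` is an isometry, and the right factor `Q⁻¹` only changes the orthonormal
basis in which the trace is taken. -/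
theorem inner_frob_conj (P P' : E N →L[ℝ] E N) (Q : O N) :
    ⟪frob N (act Q ∘L P ∘L act Q⁻¹), frob N (act Q ∘L P' ∘L act Q⁻¹)⟫_ℝ =
      ⟪frob N P, frob N P'⟫_ℝ := by
  let b := EuclideanSpace.basisFun (Fin N) ℝ
  rw [inner_frob b, inner_frob (b.map (actIso Q⁻¹))]
  simp [inner_act, act_inv_act, actIso_apply]

theorem norm_frob_conj (P : E N →L[ℝ] E N) (Q : O N) :
    ‖frob N (act Q ∘L P ∘L act Q⁻¹)‖ = ‖frob N P‖ := by
  rw [norm_eq_sqrt_real_inner, inner_frob_conj, ← norm_eq_sqrt_real_inner]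

end Frobenius

/-! ### The canonical metric as an induced metric. -/

namespace Gr

variable {m N : ℕ}

/-- The orthonormal basis `Y, Z` of `ℝ^N` adapted to a plane. -/
noncomputable def adaptedBasis (V : Gr m N) :
    OrthonormalBasis (Fin m ⊕ Fin (N - m)) ℝ (E N) :=
  OrthonormalBasis.mk (v := Sum.elim V.Y V.Z) (by
    rw [orthonormal_iff_ite]
    rintro (i | i) (l | l)
    · simp [inner_Y_Y]
    · simp [inner_Y_Z]
    · simp [inner_Z_Y]
    · simp [inner_Z_Z]) (by
    intro x _
    rw [V.expand x]
    refine Submodule.add_mem _ (Submodule.sum_mem _ fun i _ => Submodule.smul_mem _ _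
      (Submodule.subset_span ⟨Sum.inl i, rfl⟩)) (Submodule.sum_mem _ fun i _ =>
        Submodule.smul_mem _ _ (Submodule.subset_span ⟨Sum.inr i, rfl⟩)))

theorem adaptedBasis_inl (V : Gr m N) (i : Fin m) : V.adaptedBasis (Sum.inl i) = V.Y i := by
  simp [adaptedBasis]

theorem adaptedBasis_inr (V : Gr m N) (i : Fin (N - m)) : V.adaptedBasis (Sum.inr i) = V.Z i := by
  simp [adaptedBasis]

/-- The embedding of the Grassmannian by the matrix of the orthogonal projection. -/
noncomputable def emb (V : Gr m N) : EuclideanSpace ℝ (Fin N × Fin N) := frob N V.proj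

theorem contMDiff_emb :
    ContMDiff 𝓘(ℝ, GrModel m N) 𝓘(ℝ, EuclideanSpace ℝ (Fin N × Fin N)) ∞
      (emb : Gr m N → _) :=
  (frob N).contDiff.contMDiff.comp contMDiff_proj

theorem chart_self (V : Gr m N) : V.chart V = 0 := by
  have h : V.bot V = 0 := by
    ext i l
    have : V.proj (V.Y l) = V.Y l := Submodule.starProjection_eq_self_iff.2 (V.Y_mem l)
    simp [bot, this, inner_Z_Y]
  ext p
  change (V.bot V * (V.top V)⁻¹) p.1 p.2 = 0
  simp [h]

/-- The orthogonal projection onto the plane with coordinates `x` in the chart at `V`. -/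
noncomputable def projOf (V : Gr m N) (x : GrModel m N) : E N →L[ℝ] E N :=
  (V.graph (Matrix.of fun i j => x (i, j))).proj

/-- The chart at `V` sends `V` to `0`, so the differential is an ordinary derivative at `0` of the
projection written in that chart. -/
theorem differential_emb (V : Gr m N) (X : GrModel m N) :
    differential (F := GrModel m N) emb V X = frob N (fderiv ℝ V.projOf 0 X) := by
  have h1 : ContDiff ℝ ∞ V.projOf := V.contDiff_proj_graph
  have h2 : MDifferentiableAt 𝓘(ℝ, GrModel m N) 𝓘(ℝ, EuclideanSpace ℝ (Fin N × Fin N))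
    (emb : Gr m N → _) V := (contMDiff_emb V).mdifferentiableAt (by simp)
  have h3 : writtenInExtChartAt 𝓘(ℝ, GrModel m N) 𝓘(ℝ, EuclideanSpace ℝ (Fin N × Fin N)) V
    (emb : Gr m N → _) = frob N ∘ V.projOf := rfl
  have h4 : extChartAt 𝓘(ℝ, GrModel m N) V V = 0 := V.chart_self
  rw [differential, h2.mfderiv, h3, h4]
  simp only [modelWithCornersSelf_coe, Set.range_id, fderivWithin_univ]
  rw [fderiv_comp _ (frob N).differentiableAt ((h1.differentiable (by simp)) _),
    ContinuousLinearMap.fderiv]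
  rfl

theorem projOf_zero (V : Gr m N) : V.projOf 0 = V.proj := by
  have h := V.chart.left_inv (mem_chart_source (GrModel m N) V)
  rw [chart_self] at h
  exact congrArg proj h

theorem hasFDerivAt_projOf (V : Gr m N) : HasFDerivAt V.projOf (fderiv ℝ V.projOf 0) 0 := by
  have h1 : ContDiff ℝ ∞ V.projOf := V.contDiff_proj_graph
  exact ((h1.differentiable (by simp)) 0).hasFDerivAt

/-- Differentiate at `0` the identity saying that the columns of `Y + Z x` are fixed by the
projection onto their span. The term `P_V (Z X)` drops out because `Z X` is orthogonal to `V`. -/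
theorem fderiv_projOf_Y (V : Gr m N) (X : GrModel m N) (l : Fin m) :
    fderiv ℝ V.projOf 0 X (V.Y l) = ∑ i, X (i, l) • V.Z i := by
  let L : GrModel m N →L[ℝ] E N :=
    ∑ i, (EuclideanSpace.proj (i, l) : GrModel m N →L[ℝ] ℝ).smulRight (V.Z i)
  have hL : ∀ x, L x = ∑ i, x (i, l) • V.Z i := fun x => by simp [L]
  have hc : HasFDerivAt (fun x : GrModel m N => V.Y l + L x) L 0 := L.hasFDerivAt.const_add _
  have h1 := V.hasFDerivAt_projOf.clm_apply hc
  have h2 : (fun x => V.projOf x (V.Y l + L x)) = fun x => V.Y l + L x := by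
    funext x
    rw [hL]
    exact Submodule.starProjection_eq_self_iff.2 (Submodule.subset_span ⟨l, rfl⟩)
  rw [h2] at h1
  have h3 := congrArg (fun T : GrModel m N →L[ℝ] E N => T X) (hc.unique h1)
  have h4 : V.proj (L X) = 0 := by
    rw [hL]
    exact (V.1.starProjection_apply_eq_zero_iff).2
      (Submodule.sum_mem _ fun i _ => Submodule.smul_mem _ _ (V.Z_mem i))
  simp [projOf_zero, h4] at h3
  rw [← h3, hL]

/-- The vectors `Z - Y xᵀ` are orthogonal to the columns of `Y + Z x`, so the projection kills them;
differentiate this identity at `0`. -/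
theorem fderiv_projOf_Z (V : Gr m N) (X : GrModel m N) (i : Fin (N - m)) :
    fderiv ℝ V.projOf 0 X (V.Z i) = ∑ l, X (i, l) • V.Y l := by
  let L : GrModel m N →L[ℝ] E N :=
    ∑ l, (EuclideanSpace.proj (i, l) : GrModel m N →L[ℝ] ℝ).smulRight (V.Y l)
  have hL : ∀ x, L x = ∑ l, x (i, l) • V.Y l := fun x => by simp [L]
  have hc : HasFDerivAt (fun x : GrModel m N => V.Z i - L x) (-L) 0 := L.hasFDerivAt.const_sub _
  have h1 := V.hasFDerivAt_projOf.clm_apply hc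
  have h2 : (fun x => V.projOf x (V.Z i - L x)) = fun x => 0 := by
    funext x
    refine (Submodule.starProjection_apply_eq_zero_iff _).2 fun w hw => ?_
    rw [hL]
    obtain ⟨c, rfl⟩ := (Submodule.mem_span_range_iff_exists_fun ℝ).1 hw
    rw [sum_inner]
    refine Finset.sum_eq_zero fun l _ => ?_
    have h3 : ⟪V.graphVec (Matrix.of fun i j => x (i, j)) l, V.Z i⟫_ℝ = x (i, l) := by
      rw [real_inner_comm, inner_Z_graphVec]; rfl
    have h4 : ∀ l', ⟪V.graphVec (Matrix.of fun i j => x (i, j)) l, V.Y l'⟫_ℝ =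
        if l' = l then 1 else 0 := fun l' => by
      rw [real_inner_comm, inner_Y_graphVec]
    simp [inner_smul_left, inner_sub_right, inner_sum, inner_smul_right, h3, h4, mul_comm]
  rw [h2] at h1
  have h3 := congrArg (fun T : GrModel m N →L[ℝ] E N => T X) ((hasFDerivAt_const 0 0).unique h1)
  have h4 : V.proj (L X) = L X := by
    rw [hL]
    exact Submodule.starProjection_eq_self_iff.2
      (Submodule.sum_mem _ fun i _ => Submodule.smul_mem _ _ (V.Y_mem i))
  simp [projOf_zero, h4] at h3
  rw [← hL]
  exact (eq_of_sub_eq_zero (by rw [sub_eq_neg_add]; exact h3.symm))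

/-- In the basis `Y, Z` the derivative of the projection has off-diagonal blocks `X` and `Xᵀ` and no
others. Each contributes `tr (X₁ᵀ X₂)`, and the factor `1/2` in `inner_frob` compensates for the
doubling. -/
theorem isInducedBy_grMetric : IsInducedBy (grMetric m N) (emb : Gr m N → _) := by
  intro V (A : GrModel m N) (B : GrModel m N)
  rw [differential_emb, differential_emb, inner_frob V.adaptedBasis, Fintype.sum_sum_type]
  simp only [adaptedBasis_inl, adaptedBasis_inr, fderiv_projOf_Y, fderiv_projOf_Z]
  simp only [inner_sum, sum_inner, inner_smul_left, inner_smul_right, inner_Y_Y, inner_Z_Z]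
  change ⟪A, B⟫_ℝ = _
  simp [PiLp.inner_apply, Fintype.sum_prod_type]
  rw [Finset.sum_comm (s := Finset.univ (α := Fin m))]
  ring

end Gr
end AffGr

namespace AffGr

/-! ### Geodesic distance for induced metrics. -/

section GeodesicDistance

open scoped Bundle

variable {F : Type*} [NormedAddCommGroup F] [NormedSpace ℝ F] {M : Type*} [TopologicalSpace M]
  [ChartedSpace F M] {H : Type*} [NormedAddCommGroup H] [InnerProductSpace ℝ H]
  {g : Bundle.RiemannianMetric (fun x : M => TangentSpace 𝓘(ℝ, F) x)} {f : M → H}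

theorem geodesicDist_triangle (x y z : M) :
    geodesicDist g x z ≤ geodesicDist g x y + geodesicDist g y z :=
  let : Bundle.RiemannianBundle (fun x : M => TangentSpace 𝓘(ℝ, F) x) := ⟨g⟩
  Manifold.riemannianEDist_triangle

theorem geodesicDist_comm (x y : M) : geodesicDist g x y = geodesicDist g y x :=
  let : Bundle.RiemannianBundle (fun x : M => TangentSpace 𝓘(ℝ, F) x) := ⟨g⟩
  Manifold.riemannianEDist_comm

theorem geodesicDist_self (x : M) : geodesicDist g x x = 0 :=
  let : Bundle.RiemannianBundle (fun x : M => TangentSpace 𝓘(ℝ, F) x) := ⟨g⟩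
  Manifold.riemannianEDist_self

theorem eventually_geodesicDist_lt [IsManifold 𝓘(ℝ, F) ∞ M]
    (g : Bundle.ContMDiffRiemannianMetric 𝓘(ℝ, F) ∞ F (fun x : M => TangentSpace 𝓘(ℝ, F) x))
    (x : M) {c : ENNReal} (hc : 0 < c) :
    ∀ᶠ y in nhds x, geodesicDist g.toRiemannianMetric x y < c :=
  let : Bundle.RiemannianBundle (fun x : M => TangentSpace 𝓘(ℝ, F) x) := ⟨g.toRiemannianMetric⟩
  have : IsManifold 𝓘(ℝ, F) 1 M := IsManifold.of_le (n := ∞) (by simp)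
  have : IsContinuousRiemannianBundle F (fun x : M => TangentSpace 𝓘(ℝ, F) x) :=
    ⟨g.inner, g.contMDiff.continuous, fun _ _ _ => rfl⟩
  eventually_riemannianEDist_lt 𝓘(ℝ, F) x hc

theorem IsInducedBy.geodesicDist_le (hg : IsInducedBy g f)
    (hf : ContMDiff 𝓘(ℝ, F) 𝓘(ℝ, H) ∞ f) {γ : ℝ → M} (hγ : ContMDiff 𝓘(ℝ, ℝ) 𝓘(ℝ, F) 1 γ) :
    geodesicDist g (γ 0) (γ 1) ≤ ∫⁻ t in Set.Ioo 0 1, ‖deriv (f ∘ γ) t‖ₑ := by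
  let : Bundle.RiemannianBundle (fun x : M => TangentSpace 𝓘(ℝ, F) x) := ⟨g⟩
  rw [← hg.pathELength_eq (hf.mdifferentiable (by simp))
    fun t _ => (hγ t).mdifferentiableAt one_ne_zero]
  exact Manifold.riemannianEDist_le_pathELength hγ.contMDiffOn rfl rfl zero_le_one

theorem IsInducedBy.exists_path (hg : IsInducedBy g f)
    (hf : ContMDiff 𝓘(ℝ, F) 𝓘(ℝ, H) ∞ f) {x y : M} {r : ENNReal} (hr : geodesicDist g x y < r) :
    ∃ γ : ℝ → M, γ 0 = x ∧ γ 1 = y ∧ ContMDiff 𝓘(ℝ, ℝ) 𝓘(ℝ, F) 1 γ ∧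
      ∫⁻ t in Set.Ioo 0 1, ‖deriv (f ∘ γ) t‖ₑ < r := by
  let : Bundle.RiemannianBundle (fun x : M => TangentSpace 𝓘(ℝ, F) x) := ⟨g⟩
  obtain ⟨γ, h0, h1, hγ, hlt, -⟩ :=
    -- This version yields a path that is `C^1` on all of `ℝ`, so no regularity at endpoints has to
    -- be tracked later.
    Manifold.exists_lt_locally_constant_of_riemannianEDist_lt hr zero_lt_one
  refine ⟨γ, h0, h1, hγ, ?_⟩
  rwa [← hg.pathELength_eq (hf.mdifferentiable (by simp))
    fun t _ => (hγ t).mdifferentiableAt one_ne_zero]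

end GeodesicDistance

/-! ### The two smooth metrics, and why `j` does not increase distances. -/

namespace Gr

variable {m N : ℕ}

/-- The canonical metric of the Grassmannian as a smooth Riemannian metric. -/
noncomputable def smoothMetric (m N : ℕ) :
    Bundle.ContMDiffRiemannianMetric 𝓘(ℝ, GrModel m N) ∞ (GrModel m N)
      (fun V : Gr m N => TangentSpace 𝓘(ℝ, GrModel m N) V) :=
  { grMetric m N with contMDiff := isInducedBy_grMetric.contMDiff contMDiff_emb }

theorem differential_emb_injective (V : Gr m N) :
    Function.Injective (differential (F := GrModel m N) emb V) := by
  refine (injective_iff_map_eq_zero _).2 fun u hu => ?_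
  by_contra h
  have := (grMetric m N).pos V u h
  rw [isInducedBy_grMetric, hu, inner_zero_left] at this
  exact this.false

end Gr

namespace Graff

variable {k n : ℕ}

theorem contMDiff_emb_j :
    ContMDiff 𝓘(ℝ, GraffModel k n) 𝓘(ℝ, EuclideanSpace ℝ (Fin (n + 1) × Fin (n + 1))) ∞
      (fun S : Graff k n => (j S).emb) :=
  Gr.contMDiff_emb.comp contMDiff_j

theorem differential_emb_j (S : Graff k n) (u : TangentSpace 𝓘(ℝ, GraffModel k n) S) :
    differential (F := GraffModel k n) (fun S : Graff k n => (j S).emb) S u =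
      differential (F := GrModel (k + 1) (n + 1)) Gr.emb (j S)
        (mfderiv 𝓘(ℝ, GraffModel k n) 𝓘(ℝ, GrModel (k + 1) (n + 1)) j S u) := by
  have h := mfderiv_comp S ((Gr.contMDiff_emb (j S)).mdifferentiableAt (by simp))
    ((contMDiff_j S).mdifferentiableAt (by simp))
  exact congrArg (fun A : GraffModel k n →L[ℝ] EuclideanSpace ℝ (Fin (n + 1) × Fin (n + 1)) => A u)
    h

theorem differential_emb_j_injective (S : Graff k n) :
    Function.Injective
      (differential (F := GraffModel k n) (fun S : Graff k n => (j S).emb) S) := by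
  have h : Function.Injective
      (mfderiv 𝓘(ℝ, GraffModel k n) 𝓘(ℝ, GrModel (k + 1) (n + 1)) j S) := by
    rw [← isLocalDiffeomorph_j.mfderivToContinuousLinearEquiv_coe (by simp) S]
    exact (isLocalDiffeomorph_j.mfderivToContinuousLinearEquiv (by simp) S).injective
  intro u v huv
  rw [differential_emb_j, differential_emb_j] at huv
  exact h (Gr.differential_emb_injective _ huv)

/-- The pullback under `j` of the canonical metric of the Grassmannian. -/
noncomputable def smoothMetric (k n : ℕ) :
    Bundle.ContMDiffRiemannianMetric 𝓘(ℝ, GraffModel k n) ∞ (GraffModel k n)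
      (fun S : Graff k n => TangentSpace 𝓘(ℝ, GraffModel k n) S) :=
  { inducedMetric (F := GraffModel k n) (fun S : Graff k n => (j S).emb)
      differential_emb_j_injective with
    contMDiff := (isInducedBy_inducedMetric (F := GraffModel k n)
      (fun S : Graff k n => (j S).emb) differential_emb_j_injective).contMDiff contMDiff_emb_j }

theorem isInducedBy_smoothMetric :
    IsInducedBy (smoothMetric k n).toRiemannianMetric (fun S : Graff k n => (j S).emb) :=
  isInducedBy_inducedMetric _ differential_emb_j_injective

theorem smoothMetric_inner (S : Graff k n) (u v : TangentSpace 𝓘(ℝ, GraffModel k n) S) :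
    (smoothMetric k n).inner S u v = (Gr.smoothMetric (k + 1) (n + 1)).inner (j S)
      (mfderiv 𝓘(ℝ, GraffModel k n) 𝓘(ℝ, GrModel (k + 1) (n + 1)) j S u)
      (mfderiv 𝓘(ℝ, GraffModel k n) 𝓘(ℝ, GrModel (k + 1) (n + 1)) j S v) := by
  have h := isInducedBy_smoothMetric S u v
  rw [differential_emb_j, differential_emb_j, ← Gr.isInducedBy_grMetric] at h
  exact h

/-- Both metrics are induced through `Gr.emb`, so a path `γ` and its image `j ∘ γ` have the same
length. -/
theorem geodesicDist_j_le (S T : Graff k n) :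
    geodesicDist (grMetric (k + 1) (n + 1)) (j S) (j T) ≤
      geodesicDist (smoothMetric k n).toRiemannianMetric S T := by
  refine le_of_forall_gt fun r hr => ?_
  obtain ⟨γ, rfl, rfl, hγ, hlt⟩ := isInducedBy_smoothMetric.exists_path contMDiff_emb_j hr
  exact (Gr.isInducedBy_grMetric.geodesicDist_le Gr.contMDiff_emb
    ((contMDiff_j.of_le (by simp)).comp hγ)).trans_lt hlt

end Graff
end AffGr

namespace AffGr

/-! ### Null cones and random rotations. -/

section OrthogonalGroup

open MeasureTheory

variable {N : ℕ}

theorem exists_act_eq_isometry (T : E N ≃ₗᵢ[ℝ] E N) : ∃ Q : O N, ∀ x, act Q x = T x := by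
  let U : unitary (E N →L[ℝ] E N) := Unitary.linearIsometryEquiv.symm T
  have hU : ∀ x, (U : E N →L[ℝ] E N) x = T x := fun x => rfl
  let φ := (Matrix.toEuclideanCLM (𝕜 := ℝ) (n := Fin N))
  refine ⟨⟨φ.symm U, ?_⟩, fun x => ?_⟩
  · have h1 : φ.symm (U : E N →L[ℝ] E N) * φ.symm (star (U : E N →L[ℝ] E N)) = 1 :=
      (map_mul φ.symm _ _).symm.trans
        ((congrArg φ.symm (Unitary.mul_star_self_of_mem U.2)).trans (map_one φ.symm))
    rw [Matrix.mem_unitaryGroup_iff, ← h1]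
    exact congrArg _ (φ.symm.map_star' _).symm
  · rw [← hU]
    exact congrArg (fun A : E N →L[ℝ] E N => A x) (φ.apply_symm_apply U)

theorem exists_act_eq {x y : E N} (h : ‖x‖ = ‖y‖) : ∃ Q : O N, act Q x = y := by
  obtain ⟨Q, hQ⟩ := exists_act_eq_isometry (Submodule.reflection (Submodule.span ℝ {x - y})ᗮ)
  exact ⟨Q, by rw [hQ, Submodule.reflection_sub h]⟩

instance : (haarO N).IsMulLeftInvariant := by unfold haarO; infer_instance

instance : (haarO N).IsOpenPosMeasure := by unfold haarO; infer_instance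

instance : SecondCountableTopology (O N) :=
  haveI : SecondCountableTopology (Matrix (Fin N) (Fin N) ℝ) :=
    inferInstanceAs (SecondCountableTopology (Fin N → Fin N → ℝ))
  Topology.IsInducing.subtypeVal.secondCountableTopology

/-- The orbit of a nonzero vector under a random orthogonal matrix almost surely avoids a null
cone. -/
theorem haarO_act_inv_mem_cone {B : Set (E N)} (hB : μH[N] B = 0)
    (hcone : ∀ c : ℝ, ∀ x ∈ B, c • x ∈ B) {e : E N} (he : e ≠ 0) :
    haarO N {Q | act Q⁻¹ e ∈ B} = 0 := by
  let μ : Measure (E N) := μH[N]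
  let B' := toMeasurable μ B
  have hB' : μ B' = 0 := (measure_toMeasurable B).trans hB
  have hc : Continuous fun p : E N × O N => act p.2⁻¹ p.1 := by
    refine (PiLp.continuous_toLp 2 _).comp ?_
    exact Continuous.matrix_mulVec (continuous_subtype_val.comp continuous_snd.inv)
      ((PiLp.continuous_ofLp 2 _).comp continuous_fst)
  let s : Set (E N × O N) := {p | act p.2⁻¹ p.1 ∈ B'}
  have hs : MeasurableSet s := hc.measurable (measurableSet_toMeasurable μ B)
  -- Fubini: for fixed `Q` the slice is an isometric preimage of a null set, hence null. Exchanging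
  -- the order gives, for almost every `x`, a null set of `Q`; it remains to pass from one such
  -- nonzero `x` to `e`.
  have h0 : μ.prod (haarO N) s = 0 := by
    rw [Measure.prod_apply_symm hs]
    refine (lintegral_congr fun Q => ?_).trans lintegral_zero
    have := (actIso Q⁻¹).toIsometryEquiv.hausdorffMeasure_preimage N B'
    exact this.trans hB'
  have h1 : ∀ᵐ x ∂μ, haarO N {Q | act Q⁻¹ x ∈ B'} = 0 := Measure.measure_ae_null_of_prod_null h0
  obtain ⟨x, hx0, hx⟩ : ∃ x : E N, x ≠ 0 ∧ haarO N {Q | act Q⁻¹ x ∈ B'} = 0 := by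
    by_contra! hcon
    have h2 : μ {0}ᶜ = 0 := measure_mono_null (fun x hx => hcon x hx) h1
    exact (isOpen_compl_singleton.measure_pos μ ⟨e, he⟩).ne' h2
  obtain ⟨R, hR⟩ := exists_act_eq (x := (‖e‖ / ‖x‖) • x) (y := e) (by
    rw [norm_smul, norm_div, norm_norm, norm_norm, div_mul_cancel₀ _ (norm_ne_zero_iff.2 hx0)])
  have hc0 : ‖e‖ / ‖x‖ ≠ 0 := div_ne_zero (norm_ne_zero_iff.2 he) (norm_ne_zero_iff.2 hx0)
  -- Left translation by `R⁻¹` replaces `x` by a positive multiple of `e`. The scaling is absorbed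
  -- in `B` itself, since its measurable hull need not be a cone.
  rw [← measure_preimage_mul (haarO N) R⁻¹] at hx
  refine measure_mono_null (fun Q hQ => ?_) hx
  refine subset_toMeasurable μ B ?_
  have h3 : act (R⁻¹ * Q)⁻¹ x = (‖e‖ / ‖x‖)⁻¹ • act Q⁻¹ e := by
    have h4 : act R x = (‖e‖ / ‖x‖)⁻¹ • e := by
      rw [map_smul] at hR
      rw [eq_inv_smul_iff₀ hc0, hR]
    rw [mul_inv_rev, inv_inv, act_mul, h4, map_smul]
  rw [h3]
  exact hcone _ _ hQ

theorem haarO_act_mem_cone {B : Set (E N)} (hB : μH[N] B = 0)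
    (hcone : ∀ c : ℝ, ∀ x ∈ B, c • x ∈ B) {e : E N} (he : e ≠ 0) :
    haarO N {Q | act Q e ∈ B} = 0 := by
  have h := haarO_act_inv_mem_cone hB hcone he
  rw [← measure_inv_null] at h
  simpa using h

end OrthogonalGroup

/-! ### Transitivity of rotations and compactness of the Grassmannian. -/

namespace Gr

open MeasureTheory

variable {m N : ℕ}

theorem exists_rotate_eq (V W : Gr m N) : ∃ Q : O N, rotate Q V = W := by
  -- The isometry matching the adapted bases sends `Y` for `V` to `Y` for `W`.
  obtain ⟨Q, hQ⟩ := exists_act_eq_isometry (V.adaptedBasis.equiv W.adaptedBasis (Equiv.refl _))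
  refine ⟨Q, Subtype.ext (Submodule.eq_of_le_of_finrank_eq ?_ ((rotate Q V).2.trans W.2.symm))⟩
  rintro _ ⟨x, hx, rfl⟩
  change act Q x ∈ W.1
  have h : ∀ l, act Q (V.Y l) = W.Y l := fun l => by
    rw [hQ, ← adaptedBasis_inl, ← adaptedBasis_inl, OrthonormalBasis.equiv_apply_basis]; rfl
  have h2 : ∀ i, ⟪V.Z i, x⟫_ℝ = 0 := fun i => by rw [real_inner_comm]; exact V.Z_mem i x hx
  rw [V.expand x]
  simp only [h2, zero_smul, Finset.sum_const_zero, add_zero, map_sum, map_smul, h]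
  exact Submodule.sum_mem _ fun l _ => Submodule.smul_mem _ _ (W.Y_mem l)

instance : CompactSpace (Gr m N) := by
  rcases isEmpty_or_nonempty (Gr m N) with h | ⟨⟨V⟩⟩
  · infer_instance
  · refine ⟨?_⟩
    have h : Set.univ = Set.range fun Q : O N => rotate Q V :=
      (Set.range_eq_univ.2 V.exists_rotate_eq).symm
    rw [h]
    exact isCompact_range (continuous_rotate V)

theorem rotate_rotate_inv (Q : O N) (V : Gr m N) : rotate Q (rotate Q⁻¹ V) = V := by
  refine proj_injective (ContinuousLinearMap.ext fun x => ?_)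
  rw [proj_rotate, proj_rotate, inv_inv, ← act_mul, ← act_mul, mul_inv_cancel]
  simp [act]

theorem mem_orthogonal_rotate {Q : O N} {V : Gr m N} {x : E N} :
    x ∈ (rotate Q V).1ᗮ ↔ act Q⁻¹ x ∈ V.1ᗮ := by
  constructor
  · intro h v hv
    rw [← inner_act]
    exact h _ ⟨v, hv, rfl⟩
  · rintro h _ ⟨v, hv, rfl⟩
    exact (inner_act Q v x).trans (h v hv)

theorem hausdorffMeasure_orthogonal (V : Gr m N) (hm : 0 < m) :
    μH[N] ((V.1ᗮ : Submodule ℝ (E N)) : Set (E N)) = 0 := by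
  refine Measure.addHaar_submodule (μH[N] : Measure (E N)) _ fun h => ?_
  rw [Submodule.orthogonal_eq_top_iff] at h
  have := V.2
  rw [h, finrank_bot] at this
  omega

end Gr

theorem eLast_ne_zero (n : ℕ) : eLast n ≠ 0 := by
  intro h
  have := inner_eLast_self (n := n)
  rw [h, inner_zero_left] at this
  exact zero_ne_one this

/-! ### Almost every rotation of a plane lies in the image of `j`. -/

section UniformMeasure

open MeasureTheory

variable {k n : ℕ}

/-- The rotation `Q V₀` misses the image exactly when `Q⁻¹ e_{n+1}` lies in `V₀ᗮ`, a proper subspace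
and so a null cone. -/
theorem grMeasure_compl_range_j (h : k + 1 ≤ n + 1) :
    grMeasure h (Set.range (j : Graff k n → Gr (k + 1) (n + 1)))ᶜ = 0 := by
  rw [grMeasure, Measure.map_apply (continuous_rotate _).measurable
    isOpen_range_j.measurableSet.compl]
  refine measure_mono_null (fun Q hQ => ?_) (haarO_act_inv_mem_cone
    ((stdPlane h).hausdorffMeasure_orthogonal k.succ_pos)
    (fun c x hx => Submodule.smul_mem _ c hx) (eLast_ne_zero n))
  have h1 : rotate Q (stdPlane h) ∉ Set.range (j : Graff k n → Gr (k + 1) (n + 1)) := hQ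
  rw [mem_range_j_iff, not_not, Gr.mem_orthogonal_rotate] at h1
  exact h1

/-- Here `Q⁻¹ V` has to lie in the image, and it fails to do so exactly when `Q e_{n+1} ∈ Vᗮ`. -/
theorem ae_exists_rotate_j_eq (V : Gr (k + 1) (n + 1)) :
    ∀ᵐ Q ∂haarO (n + 1), ∃ S : Graff k n, rotate Q (j S) = V := by
  refine measure_mono_null (fun Q hQ => ?_) (haarO_act_mem_cone
    (V.hausdorffMeasure_orthogonal k.succ_pos)
    (fun c x hx => Submodule.smul_mem _ c hx) (eLast_ne_zero n))
  have h1 : rotate Q⁻¹ V ∉ Set.range (j : Graff k n → Gr (k + 1) (n + 1)) := by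
    rintro ⟨S, hS⟩
    exact hQ ⟨S, by rw [hS, Gr.rotate_rotate_inv]⟩
  rw [mem_range_j_iff, not_not, Gr.mem_orthogonal_rotate, inv_inv] at h1
  exact h1

end UniformMeasure

end AffGr

namespace AffGr

/-! ### Subspaces disjoint from two given ones. -/

section CommonComplement

variable {N : ℕ}

theorem exists_notMem_notMem {A B : Submodule ℝ (E N)} (hA : A ≠ ⊤) (hB : B ≠ ⊤) :
    ∃ u, u ∉ A ∧ u ∉ B := by
  obtain ⟨a, ha⟩ : ∃ a, a ∉ A := by simpa [Submodule.eq_top_iff'] using hA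
  obtain ⟨b, hb⟩ : ∃ b, b ∉ B := by simpa [Submodule.eq_top_iff'] using hB
  by_cases haB : a ∈ B
  · by_cases hbA : b ∈ A
    · exact ⟨a + b, fun h => ha ((A.add_mem_iff_left hbA).1 h),
        fun h => hb ((B.add_mem_iff_right haB).1 h)⟩
    · exact ⟨b, hbA, hb⟩
  · exact ⟨a, ha, haB⟩

theorem disjoint_sup_span_singleton {A C : Submodule ℝ (E N)} {u : E N} (hu : u ∉ A)
    (h : Disjoint C (A ⊔ Submodule.span ℝ {u})) : Disjoint (C ⊔ Submodule.span ℝ {u}) A := by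
  refine Submodule.disjoint_def.2 fun x hx hxA => ?_
  obtain ⟨c, hc, y, hy, rfl⟩ := Submodule.mem_sup.1 hx
  obtain ⟨t, rfl⟩ := Submodule.mem_span_singleton.1 hy
  have h1 : c ∈ A ⊔ Submodule.span ℝ {u} := by
    rw [← add_sub_cancel_right c (t • u)]
    exact Submodule.sub_mem _ (Submodule.mem_sup_left hxA) (Submodule.mem_sup_right hy)
  have h2 : c = 0 := Submodule.disjoint_def.1 h c hc h1
  rw [h2, zero_add] at hxA ⊢
  by_cases ht : t = 0
  · rw [ht, zero_smul]
  · exact absurd ((A.smul_mem_iff ht).1 hxA) hu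

/-- Induction on `d`: adjoin to `A` and `B` a vector `u` lying in neither, find a smaller `C`
disjoint from both enlargements, then move `u` over to `C`. -/
theorem exists_disjoint_disjoint (d : ℕ) : ∀ A B : Submodule ℝ (E N),
    Module.finrank ℝ A + d ≤ N → Module.finrank ℝ B + d ≤ N →
    ∃ C : Submodule ℝ (E N), Module.finrank ℝ C = d ∧ Disjoint C A ∧ Disjoint C B := by
  induction d with
  | zero => exact fun A B _ _ => ⟨⊥, finrank_bot _ _, disjoint_bot_left, disjoint_bot_left⟩
  | succ d ih =>
    intro A B hA hB
    have hne : ∀ A : Submodule ℝ (E N), Module.finrank ℝ A + (d + 1) ≤ N → A ≠ ⊤ := by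
      rintro A h rfl
      rw [finrank_top, finrank_euclideanSpace_fin] at h
      omega
    obtain ⟨u, huA, huB⟩ := exists_notMem_notMem (hne A hA) (hne B hB)
    have hu : u ≠ 0 := fun h => huA (h ▸ A.zero_mem)
    have hrank : ∀ A : Submodule ℝ (E N), Module.finrank ℝ A + (d + 1) ≤ N →
        Module.finrank ℝ (A ⊔ Submodule.span ℝ {u} : Submodule ℝ (E N)) + d ≤ N := by
      intro A h
      have h1 := Submodule.finrank_add_le_finrank_add_finrank A (Submodule.span ℝ {u})
      rw [finrank_span_singleton hu] at h1
      omega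
    obtain ⟨C, hC, hCA, hCB⟩ := ih _ _ (hrank A hA) (hrank B hB)
    refine ⟨C ⊔ Submodule.span ℝ {u}, ?_, disjoint_sup_span_singleton huA hCA,
      disjoint_sup_span_singleton huB hCB⟩
    have h1 := Submodule.finrank_sup_add_finrank_inf_eq C (Submodule.span ℝ {u})
    rw [(hCA.mono_right le_sup_right).eq_bot, finrank_bot, finrank_span_singleton hu, hC] at h1
    omega

end CommonComplement

/-! ### Finiteness of the geodesic distance. -/

namespace Gr

variable {m N : ℕ}

/-- A kernel vector gives `x ∈ V` with `|P_U x|² = ⟪x, P_U x⟫ = 0`, so `x ∈ Uᗮ ∩ V = 0`. -/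
theorem det_top_ne_zero {V U : Gr m N} (h : Disjoint U.1ᗮ V.1) : (V.top U).det ≠ 0 := by
  intro h0
  obtain ⟨v, hv, hv0⟩ := Matrix.exists_mulVec_eq_zero_iff.2 h0
  set x : E N := ∑ l, v l • V.Y l with hx
  have hxV : x ∈ V.1 := Submodule.sum_mem _ fun l _ => Submodule.smul_mem _ _ (V.Y_mem l)
  have hY : ∀ i, ⟪V.Y i, U.proj x⟫_ℝ = 0 := by
    intro i
    have := congrFun hv0 i
    simpa [Matrix.mulVec, dotProduct, top, hx, inner_sum, inner_smul_right, mul_comm] using this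
  have h1 : ⟪x, U.proj x⟫_ℝ = 0 := by
    rw [hx, sum_inner]
    exact Finset.sum_eq_zero fun i _ => by rw [inner_smul_left, ← hx, hY, mul_zero]
  have h2 : U.proj x = 0 := by
    have := U.1.starProjection_inner_eq_zero x _ (U.proj_mem x)
    rw [inner_sub_left] at this
    exact inner_self_eq_zero.1 ((sub_eq_zero.1 this).symm.trans h1)
  have h3 : x = 0 :=
    Submodule.disjoint_def.1 h x (U.1.starProjection_apply_eq_zero_iff.1 h2) hxV
  apply hv
  funext i
  have := congrArg (fun y => ⟪V.Y i, y⟫_ℝ) h3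
  simpa [hx, inner_sum, inner_smul_right, inner_Y_Y] using this

theorem exists_mem_source_mem_source (V W : Gr m N) :
    ∃ U, U ∈ V.chart.source ∧ U ∈ W.chart.source := by
  have hm : m ≤ N := by
    have := Submodule.finrank_le V.1
    rwa [V.2, finrank_euclideanSpace_fin] at this
  -- The plane `Cᗮ` lies in both chart domains when `C` is a common complement of `V` and `W`.
  obtain ⟨C, hC, hCV, hCW⟩ := exists_disjoint_disjoint (N - m) V.1 W.1
    (by rw [V.2]; omega) (by rw [W.2]; omega)
  have hU : Module.finrank ℝ (Cᗮ : Submodule ℝ (E N)) = m := by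
    have := Submodule.finrank_add_finrank_orthogonal C
    rw [hC, finrank_euclideanSpace_fin] at this
    omega
  have hperp : Cᗮᗮ = C := C.orthogonal_orthogonal
  exact ⟨⟨Cᗮ, hU⟩, det_top_ne_zero (hperp.symm ▸ hCV), det_top_ne_zero (hperp.symm ▸ hCW)⟩

/-- The chart target is a whole vector space, hence connected, and the coordinates of points at
finite distance from `V` form a clopen set because nearby points are at finite distance from each
other. -/
theorem geodesicDist_ne_top_of_mem_source {V U : Gr m N} (hU : U ∈ V.chart.source) :
    geodesicDist (grMetric m N) V U ≠ ⊤ := by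
  have hc : Continuous V.chart.symm := continuousOn_univ.1 V.chart.continuousOn_symm
  have hloc : ∀ x : GrModel m N, ∀ᶠ y in nhds x,
      geodesicDist (grMetric m N) (V.chart.symm x) (V.chart.symm y) ≠ ⊤ := fun x =>
    (hc.tendsto x).eventually ((eventually_geodesicDist_lt (smoothMetric m N) (V.chart.symm x)
      one_pos).mono fun W hW => (hW.trans_le le_top).ne)
  have hclopen : IsClopen {x | geodesicDist (grMetric m N) V (V.chart.symm x) ≠ ⊤} := by
    refine ⟨⟨isOpen_iff_mem_nhds.2 fun x hx => ?_⟩, isOpen_iff_mem_nhds.2 fun x hx => ?_⟩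
    · filter_upwards [hloc x] with y hy hy'
      refine hx fun htop => ?_
      have := geodesicDist_triangle (g := grMetric m N) V (V.chart.symm y) (V.chart.symm x)
      rw [htop, top_le_iff, ENNReal.add_eq_top, geodesicDist_comm (V.chart.symm y)] at this
      exact this.elim hy' hy
    · filter_upwards [hloc x] with y hy htop
      have := geodesicDist_triangle (g := grMetric m N) V (V.chart.symm x) (V.chart.symm y)
      rw [htop, top_le_iff, ENNReal.add_eq_top] at this
      exact this.elim hx hy
  have huniv := hclopen.eq_univ ⟨V.chart V, by
    rw [Set.mem_ofPred_eq, V.chart.left_inv (mem_chart_source (GrModel m N) V), geodesicDist_self]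
    exact ENNReal.zero_ne_top⟩
  have := huniv.symm ▸ Set.mem_univ (V.chart U)
  rwa [Set.mem_ofPred_eq, V.chart.left_inv hU] at this

theorem geodesicDist_ne_top (V W : Gr m N) : geodesicDist (grMetric m N) V W ≠ ⊤ := by
  obtain ⟨U, hV, hW⟩ := exists_mem_source_mem_source V W
  refine ne_top_of_le_ne_top (ENNReal.add_ne_top.2 ⟨geodesicDist_ne_top_of_mem_source hV, ?_⟩)
    (geodesicDist_triangle V U W)
  rw [geodesicDist_comm]
  exact geodesicDist_ne_top_of_mem_source hW

end Gr
end AffGr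

namespace AffGr

/-! ### Rotating a path into the image of `j`. -/

open MeasureTheory

namespace Gr

variable {m N : ℕ}

theorem eq_sum_of_mem_orthogonal_graph (V : Gr m N) (X : Matrix (Fin (N - m)) (Fin m) ℝ) {w : E N}
    (hw : w ∈ (V.graph X).1ᗮ) : w = ∑ i, ⟪V.Z i, w⟫_ℝ • (V.Z i - ∑ l, X i l • V.Y l) := by
  have h : ∀ l, ⟪V.Y l, w⟫_ℝ = - ∑ i, X i l * ⟪V.Z i, w⟫_ℝ := by
    intro l
    have := hw (V.graphVec X l) (Submodule.subset_span ⟨l, rfl⟩)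
    simp only [graphVec, inner_add_left, sum_inner, inner_smul_left, conj_trivial] at this
    linarith
  conv_lhs => rw [V.expand w]
  simp only [h, smul_sub, Finset.sum_sub_distrib, neg_smul, Finset.sum_neg_distrib,
    Finset.sum_smul, Finset.smul_sum, smul_smul]
  rw [Finset.sum_comm (s := Finset.univ (α := Fin m))]
  simp only [mul_comm]
  abel

/-- The union of the orthogonal complements along a `C^1` path of planes. -/
def orthogonalUnion (γ : ℝ → Gr m N) (I : Set ℝ) : Set (E N) :=
  {w | ∃ t ∈ I, w ∈ (γ t).1ᗮ}

/-- Near `t₀` the complements have bases `Z - Y Xᵀ` with `X` a `C^1` function of `t`. Their union is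
thus contained in a `C^1` image of a convex set with one parameter for time and `N - m` for the
vector. -/
theorem exists_dimH_orthogonalUnion_le {γ : ℝ → Gr m N}
    (hγ : ContMDiff 𝓘(ℝ, ℝ) 𝓘(ℝ, GrModel m N) 1 γ) (t₀ : ℝ) :
    ∃ I ∈ nhds t₀, dimH (orthogonalUnion γ I) ≤ (N - m + 1 : ℕ) := by
  let V := γ t₀
  have h1 : ContMDiffAt 𝓘(ℝ, GrModel m N) 𝓘(ℝ, GrModel m N) 1 V.chart V :=
    (contMDiffOn_chart (x := V) (n := 1)).contMDiffAt
      (V.chart.open_source.mem_nhds (mem_chart_source (GrModel m N) V))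
  have h2 : ContDiffAt ℝ 1 (V.chart ∘ γ) t₀ := (h1.comp t₀ (hγ t₀)).contDiffAt
  have h3 : ∀ᶠ t in nhds t₀, γ t ∈ V.chart.source :=
    hγ.continuous.continuousAt (V.chart.open_source.mem_nhds (mem_chart_source (GrModel m N) V))
  -- Being `C^1` at a point persists nearby; a ball is chosen because the dimension bound for `C^1`
  -- images needs a convex domain.
  obtain ⟨δ, hδ, hball⟩ := Metric.eventually_nhds_iff_ball.1
    (h3.and (h2.eventually (by simp)))
  let Ψ : ℝ × EuclideanSpace ℝ (Fin (N - m)) → E N := fun p =>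
    ∑ i, p.2 i • (V.Z i - ∑ l, V.chart (γ p.1) (i, l) • V.Y l)
  have hΨ : ContDiffOn ℝ 1 Ψ (Metric.ball t₀ δ ×ˢ Set.univ) := by
    have h4 : ContDiffOn ℝ 1 (fun p : ℝ × EuclideanSpace ℝ (Fin (N - m)) => V.chart (γ p.1))
        (Metric.ball t₀ δ ×ˢ Set.univ) :=
      ContDiffOn.comp (g := V.chart ∘ γ) (fun t ht => ((hball t ht).2).contDiffWithinAt)
        contDiff_fst.contDiffOn fun p hp => hp.1
    have h5 := contDiffOn_euclidean.1 h4
    have h6 : ∀ i, ContDiff ℝ 1 fun p : ℝ × EuclideanSpace ℝ (Fin (N - m)) => p.2 i :=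
      contDiff_euclidean.1 contDiff_snd
    refine ContDiffOn.sum fun i _ => (h6 i).contDiffOn.smul (contDiffOn_const.sub
      (ContDiffOn.sum fun l _ => (h5 (i, l)).smul contDiffOn_const))
  refine ⟨Metric.ball t₀ δ, Metric.ball_mem_nhds _ hδ, ?_⟩
  have hsub : orthogonalUnion γ (Metric.ball t₀ δ) ⊆ Ψ '' (Metric.ball t₀ δ ×ˢ Set.univ) := by
    rintro w ⟨t, ht, hw⟩
    refine ⟨(t, WithLp.toLp 2 fun i => ⟪V.Z i, w⟫_ℝ), ⟨ht, Set.mem_univ _⟩, ?_⟩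
    rw [← V.graph_slope (γ t) (hball t ht).1] at hw
    exact (V.eq_sum_of_mem_orthogonal_graph _ hw).symm
  calc dimH (orthogonalUnion γ (Metric.ball t₀ δ))
      ≤ dimH (Ψ '' (Metric.ball t₀ δ ×ˢ Set.univ)) := dimH_mono hsub
    _ ≤ dimH (Metric.ball t₀ δ ×ˢ (Set.univ : Set (EuclideanSpace ℝ (Fin (N - m))))) :=
        hΨ.dimH_image_le ((convex_ball _ _).prod convex_univ) subset_rfl
    _ ≤ dimH (Set.univ : Set (ℝ × EuclideanSpace ℝ (Fin (N - m)))) := dimH_mono (Set.subset_univ _)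
    _ = (N - m + 1 : ℕ) := by
        rw [Real.dimH_univ_eq_finrank]
        simp [add_comm]

/-- Countably many of the local pieces cover the line, and `N - m + 1 < N` exactly because `m ≥ 2`.
-/
theorem hausdorffMeasure_orthogonalUnion (hm : 2 ≤ m) (hmN : m ≤ N) {γ : ℝ → Gr m N}
    (hγ : ContMDiff 𝓘(ℝ, ℝ) 𝓘(ℝ, GrModel m N) 1 γ) :
    μH[N] (orthogonalUnion γ Set.univ) = 0 := by
  choose I hI hdim using exists_dimH_orthogonalUnion_le hγ
  obtain ⟨s, hs, hcover⟩ := TopologicalSpace.countable_cover_nhds hI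
  have h1 : orthogonalUnion γ Set.univ ⊆ ⋃ t ∈ s, orthogonalUnion γ (I t) := by
    rintro w ⟨t, -, hw⟩
    obtain ⟨t', ht', ht⟩ := Set.mem_iUnion₂.1 (hcover.symm ▸ Set.mem_univ t)
    exact Set.mem_iUnion₂.2 ⟨t', ht', t, ht, hw⟩
  have h2 : dimH (orthogonalUnion γ Set.univ) ≤ (N - m + 1 : ℕ) := by
    refine (dimH_mono h1).trans ?_
    rw [dimH_bUnion hs]
    exact iSup₂_le fun t _ => hdim t
  have h3 : dimH (orthogonalUnion γ Set.univ) < ((N : NNReal) : ENNReal) := by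
    refine h2.trans_lt ?_
    rw [ENNReal.coe_natCast, Nat.cast_lt]
    omega
  simpa using hausdorffMeasure_of_dimH_lt h3

theorem proj_rotate_eq (Q : O N) (V : Gr m N) :
    (rotate Q V).proj = act Q ∘L V.proj ∘L act Q⁻¹ :=
  ContinuousLinearMap.ext fun x => proj_rotate Q V x

theorem enorm_deriv_emb_rotate (Q : O N) {γ : ℝ → Gr m N}
    (hγ : ContMDiff 𝓘(ℝ, ℝ) 𝓘(ℝ, GrModel m N) 1 γ) (t : ℝ) :
    ‖deriv (fun t => (rotate Q (γ t)).emb) t‖ₑ = ‖deriv (emb ∘ γ) t‖ₑ := by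
  have h1 : ContMDiff 𝓘(ℝ, ℝ) 𝓘(ℝ, E N →L[ℝ] E N) 1 (proj ∘ γ) :=
    (contMDiff_proj.of_le (by simp)).comp hγ
  have h2 : HasDerivAt (proj ∘ γ) (deriv (proj ∘ γ) t) t :=
    (h1.contDiff.differentiable one_ne_zero t).hasDerivAt
  have h3 := (frob N).hasFDerivAt.comp_hasDerivAt t h2
  have h4 := (frob N).hasFDerivAt.comp_hasDerivAt t
    (((hasDerivAt_const t (act Q)).clm_comp (h2.clm_comp (hasDerivAt_const t (act Q⁻¹)))))
  have h5 : (fun t => (rotate Q (γ t)).emb) =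
      frob N ∘ fun t => act Q ∘L (proj ∘ γ) t ∘L act Q⁻¹ := by
    funext t
    rw [emb, proj_rotate_eq]
    rfl
  have h6 : emb ∘ γ = frob N ∘ (proj ∘ γ) := rfl
  rw [h5, h4.deriv, h6, h3.deriv, ← ofReal_norm, ← ofReal_norm, ← norm_frob_conj (deriv (proj ∘ γ) t) Q]
  simp

end Gr

namespace Graff

variable {k n : ℕ}

/-- The rotated path lifts through `j`. The lift is `C^1` since its projection coordinates are
`jInvCoord` of the conjugated projections, and conjugation preserves the length. -/
theorem geodesicDist_le_of_forall_rotate_mem_range (Q : O (n + 1)) {γ : ℝ → Gr (k + 1) (n + 1)}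
    (hγ : ContMDiff 𝓘(ℝ, ℝ) 𝓘(ℝ, GrModel (k + 1) (n + 1)) 1 γ)
    (hQ : ∀ t, rotate Q (γ t) ∈ Set.range (j : Graff k n → Gr (k + 1) (n + 1))) {S T : Graff k n}
    (hS : j S = rotate Q (γ 0)) (hT : j T = rotate Q (γ 1)) :
    geodesicDist (smoothMetric k n).toRiemannianMetric S T ≤
      ∫⁻ t in Set.Ioo 0 1, ‖deriv (Gr.emb ∘ γ) t‖ₑ := by
  choose η hη using hQ
  have h1 : ContMDiff 𝓘(ℝ, ℝ) 𝓘(ℝ, E (n + 1) →L[ℝ] E (n + 1)) 1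
      (fun t => act Q ∘L (γ t).proj ∘L act Q⁻¹) := by
    have h : ContMDiff 𝓘(ℝ, ℝ) 𝓘(ℝ, E (n + 1) →L[ℝ] E (n + 1)) 1 (Gr.proj ∘ γ) :=
      (Gr.contMDiff_proj.of_le (by simp)).comp hγ
    exact (contDiff_const.clm_comp (h.contDiff.clm_comp contDiff_const)).contMDiff
  have hηC : ContMDiff 𝓘(ℝ, ℝ) 𝓘(ℝ, GraffModel k n) 1 η := by
    intro t
    refine isSmoothCoordinate_projCoord.contMDiffAt_of_comp (by simp) ?_
    have h2 : projCoord ∘ η = jInvCoord ∘ fun t => act Q ∘L (γ t).proj ∘L act Q⁻¹ := by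
      funext t
      rw [Function.comp_apply, Function.comp_apply, ← jInvCoord_proj_j, hη, Gr.proj_rotate_eq]
    have h3 : ⟪eLast n, (act Q ∘L (γ t).proj ∘L act Q⁻¹) (eLast n)⟫_ℝ ≠ 0 := by
      rw [← Gr.proj_rotate_eq, ← hη, proj_j, inner_eLast_jProj]
      exact inv_ne_zero (inner_raise_self_ne_zero _)
    rw [h2]
    exact ((contDiffAt_jInvCoord h3).of_le (by simp)).contMDiffAt.comp t (h1 t)
  have h4 := isInducedBy_smoothMetric.geodesicDist_le contMDiff_emb_j hηC
  rw [j_injective (hS.trans (hη 0).symm), j_injective (hT.trans (hη 1).symm)]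
  refine h4.trans_eq (lintegral_congr fun t => ?_)
  have h5 : (fun S : Graff k n => (j S).emb) ∘ η = fun t => (rotate Q (γ t)).emb :=
    funext fun t => congrArg Gr.emb (hη t)
  rw [h5, Gr.enorm_deriv_emb_rotate Q hγ]

/-- Since `j` is open, the image of a small geodesic ball around `S` is a neighbourhood of `j S`,
and it contains `Q (j S)` for `Q` near `1`. -/
theorem eventually_exists_j_eq_rotate (S : Graff k n) {ε : ENNReal} (hε : 0 < ε) :
    ∀ᶠ Q in nhds (1 : O (n + 1)), ∃ S' : Graff k n, j S' = rotate Q (j S) ∧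
      geodesicDist (smoothMetric k n).toRiemannianMetric S S' < ε := by
  have h1 : rotate 1 (j S) = j S := Gr.proj_injective (ContinuousLinearMap.ext fun x => by
    rw [proj_rotate]; simp [act])
  have h2 := isLocalDiffeomorph_j.isOpenMap.image_mem_nhds
    (eventually_geodesicDist_lt (smoothMetric k n) S hε)
  have h3 := (continuous_rotate (j S)).continuousAt (x := 1)
  rw [ContinuousAt, h1] at h3
  filter_upwards [h3 h2] with Q hQ
  obtain ⟨S', hS', hj⟩ := hQ
  exact ⟨S', hj, hS'⟩

/-- An arbitrarily small rotation pushes an almost shortest path in the Grassmannian off the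
complement of the image, at no cost in length and at cost `ε / 2` at each endpoint. -/
theorem geodesicDist_le_geodesicDist_j (hk : 0 < k) (hkn : k ≤ n) (S T : Graff k n) :
    geodesicDist (smoothMetric k n).toRiemannianMetric S T ≤
      geodesicDist (grMetric (k + 1) (n + 1)) (j S) (j T) := by
  refine le_of_forall_gt_imp_ge_of_dense fun r hr => ?_
  obtain ⟨γ, h0, h1, hγ, hlt⟩ := Gr.isInducedBy_grMetric.exists_path Gr.contMDiff_emb hr
  refine ENNReal.le_of_forall_pos_le_add fun ε hε _ => ?_
  have hε2 : (0 : ENNReal) < ε / 2 := by simpa using hε.ne'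
  have hnull : haarO (n + 1) {Q | act Q⁻¹ (eLast n) ∈ Gr.orthogonalUnion γ Set.univ} = 0 := by
    refine haarO_act_inv_mem_cone (Gr.hausdorffMeasure_orthogonalUnion (by omega) (by omega) hγ)
      ?_ (eLast_ne_zero n)
    rintro c x ⟨t, ht, hx⟩
    exact ⟨t, ht, Submodule.smul_mem _ c hx⟩
  obtain ⟨Q, hQ, ⟨S', hjS, hS'⟩, T', hjT, hT'⟩ : ∃ Q : O (n + 1),
      act Q⁻¹ (eLast n) ∉ Gr.orthogonalUnion γ Set.univ ∧
      (∃ S' : Graff k n, j S' = rotate Q (j S) ∧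
        geodesicDist (smoothMetric k n).toRiemannianMetric S S' < ε / 2) ∧
      (∃ T' : Graff k n, j T' = rotate Q (j T) ∧
        geodesicDist (smoothMetric k n).toRiemannianMetric T T' < ε / 2) := by
    by_contra! hcon
    -- A neighbourhood of `1` has positive Haar measure, so it is not contained in the null set of
    -- bad rotations.
    refine (Measure.measure_pos_of_mem_nhds (haarO (n + 1)) ((eventually_exists_j_eq_rotate S
      hε2).and (eventually_exists_j_eq_rotate T hε2))).ne' (measure_mono_null ?_ hnull)
    rintro Q ⟨hS, T', hjT, hT'⟩
    by_contra hQ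
    exact (hcon Q hQ hS T' hjT).not_gt hT'
  have hmem : ∀ t, rotate Q (γ t) ∈ Set.range (j : Graff k n → Gr (k + 1) (n + 1)) := by
    intro t
    rw [mem_range_j_iff, Gr.mem_orthogonal_rotate]
    exact fun h => hQ ⟨t, Set.mem_univ t, h⟩
  have h2 := geodesicDist_le_of_forall_rotate_mem_range Q hγ hmem (hjS.trans (by rw [h0]))
    (hjT.trans (by rw [h1]))
  calc geodesicDist (smoothMetric k n).toRiemannianMetric S T
      ≤ geodesicDist (smoothMetric k n).toRiemannianMetric S S' +
        (geodesicDist (smoothMetric k n).toRiemannianMetric S' T' +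
          geodesicDist (smoothMetric k n).toRiemannianMetric T' T) :=
        (geodesicDist_triangle S S' T).trans (add_le_add_right (geodesicDist_triangle S' T' T) _)
    _ ≤ ε / 2 + (r + ε / 2) := by
        rw [geodesicDist_comm T' T]
        exact add_le_add hS'.le (add_le_add (h2.trans hlt.le) hT'.le)
    _ = r + ε := by
        rw [add_left_comm, ENNReal.add_halves]

end Graff
end AffGr

/-! ### The main theorem. -/

open AffGr in
theorem mainTheorem3 (k n : ℕ) (hk : 0 < k) (hkn : k ≤ n) :
    -- both spaces are Hausdorff, second countable smooth manifolds
    T2Space (Gr (k + 1) (n + 1)) ∧ SecondCountableTopology (Gr (k + 1) (n + 1)) ∧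
    T2Space (Graff k n) ∧ SecondCountableTopology (Graff k n) ∧
    ∃ (_ : IsManifold 𝓘(ℝ, GrModel (k + 1) (n + 1)) ∞ (Gr (k + 1) (n + 1)))
      (_ : IsManifold 𝓘(ℝ, GraffModel k n) ∞ (Graff k n)),
    -- `j` is a diffeomorphism onto an open subset
    Topology.IsOpenEmbedding (j : Graff k n → Gr (k + 1) (n + 1)) ∧
    IsLocalDiffeomorph 𝓘(ℝ, GraffModel k n) 𝓘(ℝ, GrModel (k + 1) (n + 1)) ∞
      (j : Graff k n → Gr (k + 1) (n + 1)) ∧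
    -- the dimensions agree
    (∀ S : Graff k n,
      Module.finrank ℝ (TangentSpace 𝓘(ℝ, GraffModel k n) S) = (n - k) * (k + 1)) ∧
    (∀ V : Gr (k + 1) (n + 1),
      Module.finrank ℝ (TangentSpace 𝓘(ℝ, GrModel (k + 1) (n + 1)) V) = (n - k) * (k + 1)) ∧
    -- the canonical metric `G` is smooth and induces a smooth Riemannian metric `g` through `j`
    (∃ (G : Bundle.ContMDiffRiemannianMetric 𝓘(ℝ, GrModel (k + 1) (n + 1)) ∞
          (GrModel (k + 1) (n + 1))
          (fun V : Gr (k + 1) (n + 1) => TangentSpace 𝓘(ℝ, GrModel (k + 1) (n + 1)) V))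
        (g : Bundle.ContMDiffRiemannianMetric 𝓘(ℝ, GraffModel k n) ∞ (GraffModel k n)
          (fun S : Graff k n => TangentSpace 𝓘(ℝ, GraffModel k n) S)),
      G.toRiemannianMetric = grMetric (k + 1) (n + 1) ∧
      (∀ (S : Graff k n) (u v : TangentSpace 𝓘(ℝ, GraffModel k n) S),
        g.inner S u v = G.inner (j S)
          (mfderiv 𝓘(ℝ, GraffModel k n) 𝓘(ℝ, GrModel (k + 1) (n + 1)) j S u)
          (mfderiv 𝓘(ℝ, GraffModel k n) 𝓘(ℝ, GrModel (k + 1) (n + 1)) j S v)) ∧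
      -- geodesic distances are finite and agree
      ∀ S T : Graff k n,
        geodesicDist g.toRiemannianMetric S T = geodesicDist G.toRiemannianMetric (j S) (j T) ∧
        geodesicDist g.toRiemannianMetric S T ≠ ⊤) ∧
    -- the complement of the affine Grassmannian is null for the uniform probability measure
    grMeasure (Nat.succ_le_succ hkn) (Set.range (j : Graff k n → Gr (k + 1) (n + 1)))ᶜ = 0 ∧
    -- an extended function has extrema, which for almost every rotation are attained in `Graff`
    (∀ (f : Graff k n → ℝ) (F : Gr (k + 1) (n + 1) → ℝ), Continuous f → Continuous F →
      (∀ S, F (j S) = f S) →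
      (∃ V, ∀ W, F V ≤ F W) ∧ (∃ V, ∀ W, F W ≤ F V) ∧
      ∀ᵐ Q ∂haarO (n + 1),
        (∃ S : Graff k n, ∀ W, F (rotate Q (j S)) ≤ F (rotate Q W)) ∧
        (∃ S : Graff k n, ∀ W, F (rotate Q W) ≤ F (rotate Q (j S)))) ∧
    -- random extremizers with absolutely continuous laws almost surely lie in `Graff`
    (∀ (Ω : Type*) (_ : MeasurableSpace Ω) (P : MeasureTheory.Measure Ω),
      MeasureTheory.IsProbabilityMeasure P →
      ∀ (F : Ω → Gr (k + 1) (n + 1) → ℝ) (X : Ω → Gr (k + 1) (n + 1)),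
      (∀ s, Continuous (F s)) → AEMeasurable X P →
      (P.map X).AbsolutelyContinuous (grMeasure (Nat.succ_le_succ hkn)) →
      ((∀ s W, F s (X s) ≤ F s W) →
        ∀ᵐ s ∂P, ∃ S : Graff k n, j S = X s ∧ ∀ W, F s (j S) ≤ F s W) ∧
      ((∀ s W, F s W ≤ F s (X s)) →
        ∀ᵐ s ∂P, ∃ S : Graff k n, j S = X s ∧ ∀ W, F s W ≤ F s (j S))) := by
  have hnull := grMeasure_compl_range_j (k := k) (Nat.succ_le_succ hkn)
  refine ⟨inferInstance, inferInstance, inferInstance, inferInstance, inferInstance, inferInstance,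
    isOpenEmbedding_j, isLocalDiffeomorph_j, fun S => ?_, fun V => ?_,
    ⟨Gr.smoothMetric (k + 1) (n + 1), Graff.smoothMetric k n, rfl, Graff.smoothMetric_inner,
      fun S T => ?_⟩, hnull, fun f F _ hF _ => ?_, fun Ω _ P _ F X _ hX hac => ?_⟩
  · exact (finrank_euclideanSpace (𝕜 := ℝ) (ι := Fin (n - k) × Fin (k + 1))).trans (by simp)
  · exact (finrank_euclideanSpace (𝕜 := ℝ)
      (ι := Fin (n + 1 - (k + 1)) × Fin (k + 1))).trans (by simp)
  · have h := (Graff.geodesicDist_le_geodesicDist_j hk hkn S T).antisymm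
      (Graff.geodesicDist_j_le S T)
    exact ⟨h, h ▸ Gr.geodesicDist_ne_top _ _⟩
  · have : Nonempty (Gr (k + 1) (n + 1)) := ⟨stdPlane (Nat.succ_le_succ hkn)⟩
    obtain ⟨V, -, hV⟩ := isCompact_univ.exists_isMinOn Set.univ_nonempty hF.continuousOn
    obtain ⟨V', -, hV'⟩ := isCompact_univ.exists_isMaxOn Set.univ_nonempty hF.continuousOn
    have hmin : ∀ W, F V ≤ F W := fun W => hV (Set.mem_univ W)
    have hmax : ∀ W, F W ≤ F V' := fun W => hV' (Set.mem_univ W)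
    refine ⟨⟨V, hmin⟩, ⟨V', hmax⟩, ?_⟩
    -- One fixed minimizer and one fixed maximizer suffice: for almost every `Q` both are of the
    -- form `Q (j S)`.
    filter_upwards [ae_exists_rotate_j_eq (k := k) V, ae_exists_rotate_j_eq (k := k) V'] with Q h h'
    obtain ⟨S, hS⟩ := h
    obtain ⟨S', hS'⟩ := h'
    exact ⟨⟨S, fun W => hS ▸ hmin _⟩, ⟨S', fun W => hS' ▸ hmax _⟩⟩
  · have h : ∀ᵐ s ∂P, X s ∈ Set.range (j : Graff k n → Gr (k + 1) (n + 1)) :=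
      MeasureTheory.ae_of_ae_map hX (hac hnull)
    refine ⟨fun hmin => ?_, fun hmax => ?_⟩
    · filter_upwards [h] with s ⟨S, hS⟩
      exact ⟨S, hS, hS ▸ hmin s⟩
    · filter_upwards [h] with s ⟨S, hS⟩
      exact ⟨S, hS, hS ▸ hmax s⟩
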